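/- Let $n\ge 0$. Superfields are families parametrized by a superdomain $B=U^{p|L}$, where $U\subset\mathbb{R}^p$ is open and $\eta_1,\dots,\eta_L$ are the odd coordinates of $B$ ($p,L\ge 0$ arbitrary). Let $(x,y,\theta_1,\theta_2)$ be the coordinates of $\mathbb{R}^{2|2}$. A superfield $\Phi\colon\mathbb{R}^{2|2}\to\mathbb{R}^{n+1}$ is an $(n+1)$-tuple of even functions on $\mathbb{R}^{2|2}\times B$, i.e. of smooth maps from $\mathbb{R}^2\times U$ to the even part of the real Grassmann algebra $\Lambda[\theta_1,\theta_2,\eta_1,\dots,\eta_L]$. Write $\Phi=u+\theta_1\psi_1+\theta_2\psi_2+\theta_1\theta_2F$ with $u,\psi_1,\psi_2,F$ free of $\theta_1,\theta_2$ ($u,F$ even, $\psi_a$ odd). Let $\langle v,w\rangle=\sum_i v_iw_i$. The superfield has values in $S^n\subset\mathbb{R}^{n+1}$ if $\langle\Phi,\Phi\rangle=1$. Set $\mathrm{pr}(u)v=v-\langle v,u\rangle u$ and $F'=\mathrm{pr}(u)F$. Let $\nabla_x\psi_a=\mathrm{pr}(u)\partial_x\psi_a$, $\nabla_y\psi_a=\mathrm{pr}(u)\partial_y\psi_a$,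 and $$(D\!\!\!\!/_u\psi)_1=\nabla_y\psi_1-\nabla_x\psi_2,\qquad (D\!\!\!\!/_u\psi)_2=-\nabla_x\psi_1-\nabla_y\psi_2 .$$ Let $(R(X,Y)Z)_l=\sum_{i,j,k}(\delta_{il}\delta_{jk}-\delta_{ik}\delta_{jl})X_iY_jZ_k$ be the curvature of $S^n$ (extended to odd arguments, factors in this order), let $\varepsilon^{ab}$ be antisymmetric with $\varepsilon^{12}=1$, and consider the Lagrangian $$L(\Phi)=-\tfrac12|du|^2+\tfrac12\big(\langle\psi_1,(D\!\!\!\!/_u\psi)_2\rangle-\langle\psi_2,(D\!\!\!\!/_u\psi)_1\rangle\big)+\tfrac1{12}\varepsilon^{ab}\varepsilon^{cd}\langle\psi_a,R(\psi_b,\psi_c)\psi_d\rangle+\tfrac12\langle F',F'\rangle .$$ A superfield $\Phi\colon\mathbb{R}^{2|2}\to S^n$ is superharmonic if it is a critical point of the action $\int L(\Phi)\,dx\,dy$, in the following sense. For every $L'\ge L$, every compact $K\subset\mathbb{R}^2$ and every family $(\Phi_t)_{t\in\mathbb{R}}$ of superfields $\mathbb{R}^{2|2}\to S^n$ parametrized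 by $U^{p|L'}$ (that is, $\Phi$ is pulled back to a parameter space with possibly more odd coordinates), smooth in $t$ and all even variables jointly, with $\Phi_0=\Phi$ and with $\Phi_t=\Phi$ outside $K$ for all $t$, one has $$\frac{d}{dt}\Big|_{t=0}\int_K L(\Phi_t)\,dx\,dy=0\quad\text{at every } b\in U .$$ Let $$D_1=\partial_{\theta_1}-\theta_1\partial_x-\theta_2\partial_y,\quad D_2=\partial_{\theta_2}-\theta_1\partial_y+\theta_2\partial_x,\quad D=\tfrac12(D_1-iD_2),\quad \bar D=\tfrac12(D_1+iD_2),$$ acting coordinatewise on functions with values in the complexified Grassmann algebra (left derivatives in $\theta_a$), and extend $\langle\cdot,\cdot\rangle$ complex bilinearly. **Theorem.** A superfield $\Phi\colon\mathbb{R}^{2|2}\to S^n$ is superharmonic if and only if $$\bar D D\Phi+\langle\bar D\Phi,D\Phi\rangle\,\Phi=0\quad\text{in }\mathbb{R}^{n+1}.$$ -/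

import Mathlib

open scoped ContDiff

noncomputable section

namespace SuperSphere

/-- The complexified Grassmann algebra on the two odd coordinates `θ₁, θ₂` of `ℝ^{2|2}`
(generators `0, 1`) and on the `L` odd coordinates `η₁, …, η_L` of the parameter space
(generators `2, …, L + 1`).  Values of functions on `ℝ^{2|2} × B` are `ℂ`-linear combinations of
products of these generators. -/
def Gr (L : ℕ) : Type := ExteriorAlgebra ℂ (Fin (2 + L) →₀ ℂ)

instance (L : ℕ) : Ring (Gr L) := inferInstanceAs (Ring (ExteriorAlgebra ℂ (Fin (2 + L) →₀ ℂ)))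

instance (L : ℕ) : Algebra ℂ (Gr L) :=
  inferInstanceAs (Algebra ℂ (ExteriorAlgebra ℂ (Fin (2 + L) →₀ ℂ)))

/-- The basis of monomials in the generators. -/
def monomialBasis (L : ℕ) : Module.Basis (Finset (Fin (2 + L))) ℂ (Gr L) :=
  (Finsupp.basisSingleOne (R := ℂ) (ι := Fin (2 + L))).ExteriorAlgebra

/-- The sup norm of the coefficients.  `Gr L` is finite-dimensional, so smoothness, derivatives and
integrals of `Gr L`-valued functions do not depend on this choice of norm. -/
instance (L : ℕ) : NormedAddCommGroup (Gr L) :=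
  NormedAddCommGroup.induced (Gr L) (Finset (Fin (2 + L)) → ℂ)
    (monomialBasis L).equivFun.toLinearMap (monomialBasis L).equivFun.injective

instance (L : ℕ) : NormedSpace ℂ (Gr L) :=
  NormedSpace.induced ℂ (Gr L) (Finset (Fin (2 + L)) → ℂ) (monomialBasis L).equivFun.toLinearMap

instance (L : ℕ) : FiniteDimensional ℂ (Gr L) := (monomialBasis L).finiteDimensional_of_finite

/-- The odd generators. -/
def gen {L : ℕ} (i : Fin (2 + L)) : Gr L := ExteriorAlgebra.ι ℂ (Finsupp.single i 1)

/-- The odd coordinates of `ℝ^{2|2}`: `θ 0` is `θ₁` and `θ 1` is `θ₂`. -/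
def θ {L : ℕ} (a : Fin 2) : Gr L := gen (Fin.castAdd L a)

/-- The real form of `Gr L`: the real Grassmann algebra on the same generators. -/
def realPart (L : ℕ) : Subalgebra ℝ (Gr L) := Algebra.adjoin ℝ (Set.range gen)

/-- The even elements. -/
def evenPart (L : ℕ) : Submodule ℂ (Gr L) :=
  CliffordAlgebra.evenOdd (0 : QuadraticForm ℂ (Fin (2 + L) →₀ ℂ)) 0

/-- The left derivative `∂/∂θ_a`: the odd derivation with `∂θ_a/∂θ_b = δ_ab`, `∂η_j/∂θ_a = 0`. -/
def dθ {L : ℕ} (a : Fin 2) : Gr L →ₗ[ℂ] Gr L :=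
  CliffordAlgebra.contractLeft (Q := (0 : QuadraticForm ℂ (Fin (2 + L) →₀ ℂ)))
    (Finsupp.lapply (Fin.castAdd L a))

/-- Restriction `i^*` along `i : ℝ² → ℝ^{2|2}`: `θ₁, θ₂ ↦ 0`, `η_j ↦ η_j`. -/
def restr {L : ℕ} : Gr L →ₐ[ℂ] Gr L :=
  ExteriorAlgebra.map (Finsupp.linearCombination ℂ
    (Fin.addCases (fun _ : Fin 2 => 0) (fun j : Fin L => Finsupp.single (Fin.natAdd 2 j) 1)))

/-- The inclusion `Gr L → Gr L'` for `L ≤ L'`: pull-back to a parameter space with additional odd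
coordinates. -/
def extend {L L' : ℕ} (h : L ≤ L') : Gr L →ₐ[ℂ] Gr L' :=
  ExteriorAlgebra.map (Finsupp.lmapDomain ℂ ℂ (Fin.castLE (Nat.add_le_add_left h 2)))

/-- Points `((x, y), b)`: even coordinates of `ℝ^{2|2}` and even coordinates of the parameter
space. -/
abbrev Pt (p : ℕ) : Type := (ℝ × ℝ) × (Fin p → ℝ)

/-- `∂f/∂x`. -/
def dx {p L : ℕ} (f : Pt p → Gr L) (z : Pt p) : Gr L :=
  deriv (fun s : ℝ => f ((s, z.1.2), z.2)) z.1.1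

/-- `∂f/∂y`. -/
def dy {p L : ℕ} (f : Pt p → Gr L) (z : Pt p) : Gr L :=
  deriv (fun s : ℝ => f ((z.1.1, s), z.2)) z.1.2

/-- `D₁ = ∂/∂θ₁ - θ₁ ∂/∂x - θ₂ ∂/∂y`. -/
def D₁ {p L : ℕ} (f : Pt p → Gr L) (z : Pt p) : Gr L :=
  dθ 0 (f z) - θ 0 * dx f z - θ 1 * dy f z

/-- `D₂ = ∂/∂θ₂ - θ₁ ∂/∂y + θ₂ ∂/∂x`. -/
def D₂ {p L : ℕ} (f : Pt p → Gr L) (z : Pt p) : Gr L :=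
  dθ 1 (f z) - θ 0 * dy f z + θ 1 * dx f z

/-- `D = (D₁ - i D₂) / 2`. -/
def D {p L : ℕ} (f : Pt p → Gr L) (z : Pt p) : Gr L :=
  (1 / 2 : ℂ) • (D₁ f z - Complex.I • D₂ f z)

/-- `D̄ = (D₁ + i D₂) / 2`. -/
def Dbar {p L : ℕ} (f : Pt p → Gr L) (z : Pt p) : Gr L :=
  (1 / 2 : ℂ) • (D₁ f z + Complex.I • D₂ f z)

/-- Vectors with `N` coordinates in `Gr L`. -/
abbrev Vec (N L : ℕ) : Type := Fin N → Gr L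

/-- A linear operator on functions, applied to each coordinate of a vector-valued function. -/
def coordwise {p N L : ℕ} (T : (Pt p → Gr L) → Pt p → Gr L) (V : Pt p → Vec N L) :
    Pt p → Vec N L :=
  fun z i => T (fun w => V w i) z

/-- The bilinear extension `⟨v, w⟩ = ∑ᵢ vᵢ wᵢ` (in this order) of the Euclidean inner product. -/
def pair {N L : ℕ} (v w : Vec N L) : Gr L := ∑ i, v i * w i

/-- `Φ` is a superfield `ℝ^{2|2} → ℝ^N` parametrized by the superdomain `B` with underlying open
set `U ⊆ ℝ^p` and with `L` odd coordinates: its coordinates are smooth, real and even. -/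
structure IsSuperfield {p N L : ℕ} (U : Set (Fin p → ℝ)) (Φ : Pt p → Vec N L) : Prop where
  smooth : ContDiffOn ℝ ∞ Φ (Set.univ ×ˢ U)
  real : ∀ z ∈ Set.univ ×ˢ U, ∀ i, Φ z i ∈ realPart L
  even : ∀ z ∈ Set.univ ×ˢ U, ∀ i, Φ z i ∈ evenPart L

/-- `Φ` is a superfield with values in the unit sphere of `ℝ^N`: `|Φ|² - 1 = 0`. -/
structure IsSphereSuperfield {p N L : ℕ} (U : Set (Fin p → ℝ)) (Φ : Pt p → Vec N L) : Prop
    extends IsSuperfield U Φ where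
  sphere : ∀ z ∈ Set.univ ×ˢ U, pair (Φ z) (Φ z) = 1

/-! Component fields of `Φ = u + θ₁ ψ₁ + θ₂ ψ₂ + θ₁ θ₂ F`. -/

/-- The component `u`. -/
def compU {p N L : ℕ} (Φ : Pt p → Vec N L) (z : Pt p) : Vec N L := fun i => restr (Φ z i)

/-- The components `ψ_a` (`a = 0, 1` for `ψ₁, ψ₂`). -/
def compψ {p N L : ℕ} (Φ : Pt p → Vec N L) (a : Fin 2) (z : Pt p) : Vec N L :=
  fun i => restr (dθ a (Φ z i))

/-- The component `F` (of the writing in `ℝ^N`). -/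
def compF {p N L : ℕ} (Φ : Pt p → Vec N L) (z : Pt p) : Vec N L :=
  fun i => restr (dθ 1 (dθ 0 (Φ z i)))

/-- The orthogonal projection `pr(u) v = v - ⟨v, u⟩ u` onto the tangent space of the sphere. -/
def pr {N L : ℕ} (u v : Vec N L) : Vec N L := fun i => v i - pair v u * u i

/-- The component `F' = pr(u) F` (of the writing in the sphere). -/
def compF' {p N L : ℕ} (Φ : Pt p → Vec N L) (z : Pt p) : Vec N L :=
  pr (compU Φ z) (compF Φ z)

/-- The covariant derivative `∇_x ψ_a` along `u`. -/
def nablaX {p N L : ℕ} (Φ : Pt p → Vec N L) (a : Fin 2) (z : Pt p) : Vec N L :=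
  pr (compU Φ z) (coordwise dx (compψ Φ a) z)

/-- The covariant derivative `∇_y ψ_a` along `u`. -/
def nablaY {p N L : ℕ} (Φ : Pt p → Vec N L) (a : Fin 2) (z : Pt p) : Vec N L :=
  pr (compU Φ z) (coordwise dy (compψ Φ a) z)

/-- The Dirac operator: `(∇_y ψ₁ - ∇_x ψ₂, -∇_x ψ₁ - ∇_y ψ₂)`. -/
def dirac {p N L : ℕ} (Φ : Pt p → Vec N L) (z : Pt p) : Fin 2 → Vec N L :=
  ![nablaY Φ 0 z - nablaX Φ 1 z, -nablaX Φ 0 z - nablaY Φ 1 z]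

/-- The curvature tensor `R(X, Y)Z = ⟨Y, Z⟩ X - ⟨X, Z⟩ Y` of the unit sphere, extended multilinearly
to Grassmann coordinates:
`(R(X, Y)Z)_l = ∑_{i j k} (δ_{il} δ_{jk} - δ_{ik} δ_{jl}) X_i Y_j Z_k`, factors in this order. -/
def curv {N L : ℕ} (X Y Z : Vec N L) : Vec N L :=
  fun l => ∑ i, ∑ j, ∑ k,
    (((if i = l then 1 else 0) * (if j = k then 1 else 0)
      - (if i = k then 1 else 0) * (if j = l then 1 else 0) : ℂ)) • (X i * Y j * Z k)

/-- The antisymmetric symbol, `ε^{12} = 1`. -/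
def eps : Fin 2 → Fin 2 → ℂ := ![![0, 1], ![-1, 0]]

/-- The supersymmetric Lagrangian of a superfield with values in the sphere,
`-½|du|² + ½⟨ψ D̸ᵤ ψ⟩ + (1/12) ε^{ab} ε^{cd} ⟨ψ_a, R(ψ_b, ψ_c)ψ_d⟩ + ½|F'|²`, where
`⟨ψ D̸ᵤ ψ⟩ = ⟨ψ₁, (D̸ᵤψ)₂⟩ - ⟨ψ₂, (D̸ᵤψ)₁⟩`. -/
def lagrangian {p N L : ℕ} (Φ : Pt p → Vec N L) (z : Pt p) : Gr L :=
  -((1 / 2 : ℂ) • (pair (coordwise dx (compU Φ) z) (coordwise dx (compU Φ) z)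
      + pair (coordwise dy (compU Φ) z) (coordwise dy (compU Φ) z)))
    + (1 / 2 : ℂ) • (pair (compψ Φ 0 z) (dirac Φ z 1) - pair (compψ Φ 1 z) (dirac Φ z 0))
    + (1 / 12 : ℂ) • (∑ a, ∑ b, ∑ c, ∑ d, (eps a b * eps c d) •
        pair (compψ Φ a z) (curv (compψ Φ b z) (compψ Φ c z) (compψ Φ d z)))
    + (1 / 2 : ℂ) • pair (compF' Φ z) (compF' Φ z)

/-- The action over `K ⊆ ℝ²`, at the even parameter `b`. -/
def action {p N L : ℕ} (K : Set (ℝ × ℝ)) (Φ : Pt p → Vec N L) (b : Fin p → ℝ) : Gr L :=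
  ∫ ζ in K, lagrangian Φ (ζ, b)

/-- `Ψ` is a smooth variation of `Φ`, through superfields with values in the sphere, that is
supported in `K`.  It is defined over a parameter space with `L' ≥ L` odd coordinates. -/
structure IsVariation {p N L L' : ℕ} (h : L ≤ L') (U : Set (Fin p → ℝ)) (K : Set (ℝ × ℝ))
    (Φ : Pt p → Vec N L) (Ψ : ℝ → Pt p → Vec N L') : Prop where
  smooth : ContDiffOn ℝ ∞ (fun q : ℝ × Pt p => Ψ q.1 q.2) (Set.univ ×ˢ (Set.univ ×ˢ U))
  field : ∀ t, IsSphereSuperfield U (Ψ t)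
  start : ∀ z ∈ Set.univ ×ˢ U, ∀ i, Ψ 0 z i = extend h (Φ z i)
  support : ∀ t, ∀ z ∈ Kᶜ ×ˢ U, ∀ i, Ψ t z i = extend h (Φ z i)

/-- `Φ` is superharmonic: it is a critical point of the action, i.e. the first variation of the
action vanishes for every compactly supported variation.  As always for families over a parameter
space with odd coordinates, variations may involve auxiliary odd parameters (the functor-of-points
form of criticality). -/
def IsSuperharmonic {p N L : ℕ} (U : Set (Fin p → ℝ)) (Φ : Pt p → Vec N L) : Prop :=
  ∀ (L' : ℕ) (h : L ≤ L') (K : Set (ℝ × ℝ)), IsCompact K →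
    ∀ Ψ : ℝ → Pt p → Vec N L', IsVariation h U K Φ Ψ →
      ∀ b ∈ U, HasDerivAt (fun t => action K (Ψ t) b) 0 0

end SuperSphere

end

/-! The component Lagrangian of a sphere-valued superfield is exactly half the θ₁θ₂-coefficient of
⟨D₁Φ, D₂Φ⟩ (`lagrangian_eq_berezin`). The constraint |Φ|² = 1 makes ψ₁, ψ₂ tangent, so the
projections in the Dirac term drop out; it also gives ⟨F, u⟩ = ⟨ψ₁, ψ₂⟩, so the quartic part of
|F'|² cancels the curvature term.

Put Δ = (D₁D₂ - D₂D₁)/2. The θ₁θ₂-coefficient of D₁g or D₂g is a divergence in x, y, so superspace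
integration by parts shows that the action has derivative -∫ ⟨V, ΔΦ⟩ (θ₁θ₂-coefficient) along a
variation with velocity V (`IsVariation.hasDerivAt_action`). On the other side, D̄D = -(i/2)Δ
because D₁² + D₂² = 0, and ⟨D̄Φ, DΦ⟩ = -(i/2)⟨D₁Φ, D₂Φ⟩ because odd vectors pair antisymmetrically.
The equation thus reads ΔΦ = -⟨D₁Φ, D₂Φ⟩Φ (`fieldEquation_iff`).

If it holds, ΔΦ is a multiple of Φ, while V is tangent, so the first variation vanishes. Conversely,
test with Φ + tρmB, where ρ is a bump function, m a product of two odd generators and B the rotation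
field in the (i, j)-plane. As m² = 0, this stays on the sphere for all t. The fundamental lemma of
the calculus of variations gives the vanishing of the θ₁θ₂-coefficient of m(Φⱼ ΔΦᵢ - Φᵢ ΔΦⱼ). With
two auxiliary odd parameters, such m detect every coefficient (`eq_zero_of_berezin_gen_mul`), so Φⱼ
ΔΦᵢ = Φᵢ ΔΦⱼ. Multiplying by Φⱼ and summing gives ΔΦᵢ = Φᵢ⟨Φ, ΔΦ⟩, and differentiating |Φ|² = 1
twice gives ⟨Φ, ΔΦ⟩ = -⟨D₁Φ, D₂Φ⟩ (`sum_mul_superLaplacian`). -/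

namespace SuperSphere

/-! ### Grassmann algebra: induction on generators, parity, expansion in θ₁, θ₂. -/

section GrassmannAlgebra

variable {L L' : ℕ}

/-- Left contraction with a linear functional on the span of the generators. -/
noncomputable def contract (d : Module.Dual ℂ (Fin (2 + L) →₀ ℂ)) : Gr L →ₗ[ℂ] Gr L :=
  CliffordAlgebra.contractLeft (Q := (0 : QuadraticForm ℂ (Fin (2 + L) →₀ ℂ))) d

theorem dθ_eq_contract (a : Fin 2) :
    (dθ a : Gr L →ₗ[ℂ] Gr L) = contract (Finsupp.lapply (Fin.castAdd L a)) := rfl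

/-- The grade involution. -/
noncomputable def inv : Gr L →ₐ[ℂ] Gr L :=
  CliffordAlgebra.involute (Q := (0 : QuadraticForm ℂ (Fin (2 + L) →₀ ℂ)))

theorem gr_ext {M : Type*} [AddCommGroup M] [Module ℂ M] {f g : Gr L →ₗ[ℂ] M} (h1 : f 1 = g 1)
    (hm : ∀ i x, f x = g x → f (gen i * x) = g (gen i * x)) : f = g := by
  refine LinearMap.ext fun x => ?_
  refine CliffordAlgebra.left_induction (Q := (0 : QuadraticForm ℂ (Fin (2 + L) →₀ ℂ)))
    (P := fun x => f x = g x) ?_ ?_ ?_ x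
  · intro r
    have e : (algebraMap ℂ (CliffordAlgebra (0 : QuadraticForm ℂ (Fin (2 + L) →₀ ℂ))) r : Gr L)
        = r • (1 : Gr L) := Algebra.algebraMap_eq_smul_one r
    exact (congrArg f e).trans (((map_smul f r _).trans (by rw [h1])).trans
      ((map_smul g r _).symm.trans (congrArg g e).symm))
  · intro x y hx hy
    exact (map_add f x y).trans ((congrArg₂ _ hx hy).trans (map_add g x y).symm)
  · intro (x : Gr L) m hx
    let gm : (Fin (2 + L) →₀ ℂ) →ₗ[ℂ] Gr L := ExteriorAlgebra.ι ℂ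
    change f (gm m * x) = g (gm m * x)
    induction m using Finsupp.induction_linear with
    | zero => rw [map_zero gm, zero_mul, map_zero, map_zero]
    | add m n hm hn => rw [map_add gm, add_mul, map_add, map_add, hm, hn]
    | single i c =>
      have e : Finsupp.single i c = c • (Finsupp.single i 1 : Fin (2 + L) →₀ ℂ) := by simp
      rw [e, map_smul gm, smul_mul_assoc, map_smul, map_smul]
      exact congrArg (c • ·) (hm i x hx)

/-- The elements satisfying `P` form a subspace; `gr_ext` shows that the quotient map by it is zero.
-/
theorem gr_induction {P : Gr L → Prop} (h1 : P 1) (hadd : ∀ x y, P x → P y → P (x + y))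
    (hsmul : ∀ (c : ℂ) x, P x → P (c • x)) (hm : ∀ i x, P x → P (gen i * x)) (x : Gr L) : P x := by
  let S : Submodule ℂ (Gr L) :=
    { carrier := {x | P x}
      add_mem' := fun {x y} hx hy => hadd x y hx hy
      zero_mem' := by simpa using hsmul 0 1 h1
      smul_mem' := fun c x hx => hsmul c x hx }
  have h : S.mkQ = 0 := by
    refine gr_ext ?_ fun i x hx => ?_
    · exact (Submodule.Quotient.mk_eq_zero S).2 h1
    · exact (Submodule.Quotient.mk_eq_zero S).2 (hm i x ((Submodule.Quotient.mk_eq_zero S).1 hx))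
  exact (Submodule.Quotient.mk_eq_zero S).1 (LinearMap.congr_fun h x)

@[simp] theorem inv_gen (i : Fin (2 + L)) : inv (gen i) = -gen i :=
  CliffordAlgebra.involute_ι _

@[simp] theorem contract_one (d : Module.Dual ℂ (Fin (2 + L) →₀ ℂ)) :
    contract d (1 : Gr L) = 0 :=
  CliffordAlgebra.contractLeft_one (Q := (0 : QuadraticForm ℂ (Fin (2 + L) →₀ ℂ))) d

theorem contract_gen_mul (d : Module.Dual ℂ (Fin (2 + L) →₀ ℂ)) (i : Fin (2 + L)) (x : Gr L) :
    contract d (gen i * x) = d (Finsupp.single i 1) • x - gen i * contract d x :=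
  CliffordAlgebra.contractLeft_ι_mul (Q := (0 : QuadraticForm ℂ (Fin (2 + L) →₀ ℂ))) _ _ _

theorem contract_contract (d e : Module.Dual ℂ (Fin (2 + L) →₀ ℂ)) (x : Gr L) :
    contract d (contract e x) = -contract e (contract d x) :=
  CliffordAlgebra.contractLeft_comm _ _ _

theorem contract_self (d : Module.Dual ℂ (Fin (2 + L) →₀ ℂ)) (x : Gr L) :
    contract d (contract d x) = 0 :=
  CliffordAlgebra.contractLeft_contractLeft _ _

theorem gen_mul_gen (i j : Fin (2 + L)) : (gen i * gen j : Gr L) = -(gen j * gen i) :=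
  eq_neg_of_add_eq_zero_left
    (ExteriorAlgebra.ι_add_mul_swap (R := ℂ) (Finsupp.single i 1) (Finsupp.single j 1))

theorem gen_mul_self (i : Fin (2 + L)) : (gen i * gen i : Gr L) = 0 :=
  ExteriorAlgebra.ι_sq_zero (R := ℂ) (Finsupp.single i 1)

theorem restr_θ (a : Fin 2) : restr (θ a : Gr L) = 0 := by
  refine (ExteriorAlgebra.map_apply_ι _ _).trans ?_
  simp only [Finsupp.linearCombination_single, one_smul, Fin.addCases_left]
  exact map_zero _

theorem restr_gen_natAdd (j : Fin L) :
    restr (gen (Fin.natAdd 2 j) : Gr L) = gen (Fin.natAdd 2 j) := by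
  refine (ExteriorAlgebra.map_apply_ι _ _).trans ?_
  simp only [Finsupp.linearCombination_single, one_smul, Fin.addCases_right]
  rfl

theorem extend_gen (h : L ≤ L') (i : Fin (2 + L)) :
    extend h (gen i : Gr L) = gen (Fin.castLE (Nat.add_le_add_left h 2) i) := by
  refine (ExteriorAlgebra.map_apply_ι _ _).trans ?_
  simp only [Finsupp.lmapDomain_apply, Finsupp.mapDomain_single]
  rfl

theorem extend_θ (h : L ≤ L') (a : Fin 2) : extend h (θ a : Gr L) = θ a := by
  rw [θ, extend_gen]; rfl

theorem extend_injective (h : L ≤ L') : Function.Injective (extend h) := by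
  refine ExteriorAlgebra.map_injective_field ?_ 
  rw [LinearMap.ker_eq_bot]
  exact Finsupp.mapDomain_injective (Fin.castLE_injective _)

theorem inv_inv (x : Gr L) : inv (inv x) = x := CliffordAlgebra.involute_involute _

/-- For the converse, split `x` into even and odd parts: the involution negates the odd part, which
must then equal its own negative. From here on, parity is expressed through `inv`. -/
theorem mem_evenPart {x : Gr L} : x ∈ evenPart L ↔ inv x = x := by
  refine ⟨fun h => CliffordAlgebra.involute_eq_of_mem_even h, fun h => ?_⟩
  have hc := CliffordAlgebra.evenOdd_isCompl (Q := (0 : QuadraticForm ℂ (Fin (2 + L) →₀ ℂ)))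
  obtain ⟨a, ha, b, hb, hab⟩ := Submodule.mem_sup.1
    ((hc.sup_eq_top).symm ▸ Submodule.mem_top : x ∈ _)
  have h1 : inv (a : Gr L) = a := CliffordAlgebra.involute_eq_of_mem_even ha
  have h2 : inv (b : Gr L) = -(b : Gr L) := CliffordAlgebra.involute_eq_of_mem_odd hb
  have hab' : ((a : Gr L) + (b : Gr L) : Gr L) = x := hab
  rw [← hab', map_add, h1, h2] at h
  have h3 : (2 : ℂ) • (b : Gr L) = 0 := by
    rw [two_smul]
    have := add_left_cancel h
    rw [neg_eq_iff_add_eq_zero] at this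
    exact this
  have h4 : (b : Gr L) = 0 := (smul_eq_zero.1 h3).resolve_left two_ne_zero
  rw [← hab', h4, add_zero]
  exact ha

theorem contract_mul (d : Module.Dual ℂ (Fin (2 + L) →₀ ℂ)) (x y : Gr L) :
    contract d (x * y) = contract d x * y + inv x * contract d y := by
  induction x using gr_induction with
  | h1 => simp
  | hadd x x' hx hx' => simp only [add_mul, map_add, hx, hx']; abel
  | hsmul c x hx => simp only [smul_mul_assoc, map_smul, hx, smul_add]
  | hm i x hx =>
    simp only [mul_assoc, contract_gen_mul, hx, map_mul, inv_gen, sub_mul, mul_add, smul_mul_assoc,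
      neg_mul]
    abel

theorem inv_contract (d : Module.Dual ℂ (Fin (2 + L) →₀ ℂ)) (x : Gr L) :
    inv (contract d x) = -contract d (inv x) := by
  induction x using gr_induction with
  | h1 => simp
  | hadd x x' hx hx' => simp only [map_add, hx, hx']; abel
  | hsmul c x hx => simp only [map_smul, hx, smul_neg]
  | hm i x hx =>
    simp only [contract_gen_mul, map_sub, hx, map_mul, inv_gen, map_smul, neg_mul, map_neg]
    abel_nf
    simp

theorem gen_mul (i : Fin (2 + L)) (x : Gr L) : gen i * x = inv x * gen i := by
  induction x using gr_induction with
  | h1 => simp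
  | hadd x x' hx hx' => simp only [map_add, hx, hx', mul_add, add_mul]
  | hsmul c x hx => simp only [map_smul, hx, smul_mul_assoc, mul_smul_comm]
  | hm j x hx =>
    rw [← mul_assoc, gen_mul_gen, neg_mul, mul_assoc, hx, map_mul, inv_gen, neg_mul, neg_mul,
      mul_assoc]

/-- `x + inv x` and `x - inv x` are twice the even and odd parts of `x`. Left multiplication by a
generator exchanges them, so the two commutation rules have to be proved by one joint induction. -/
theorem graded_comm (x : Gr L) : ∀ y : Gr L, (x + inv x) * y = y * (x + inv x) ∧
    (x - inv x) * y = inv y * (x - inv x) := by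
  induction x using gr_induction with
  | h1 => intro y; simp [mul_add, add_mul]
  | hadd x x' hx hx' =>
    intro y
    have e1 : x + x' + inv (x + x') = (x + inv x) + (x' + inv x') := by rw [map_add]; abel
    have e2 : x + x' - inv (x + x') = (x - inv x) + (x' - inv x') := by rw [map_add]; abel
    rw [e1, e2, add_mul (x + inv x), add_mul (x - inv x), mul_add _ (x + inv x),
      mul_add _ (x - inv x), (hx y).1, (hx y).2, (hx' y).1, (hx' y).2]
    exact ⟨rfl, rfl⟩
  | hsmul c x hx =>
    intro y
    rw [map_smul, ← smul_add, ← smul_sub, smul_mul_assoc, smul_mul_assoc, mul_smul_comm,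
      mul_smul_comm, (hx y).1, (hx y).2]
    exact ⟨rfl, rfl⟩
  | hm i x hx =>
    intro y
    have e1 : gen i * x + inv (gen i * x) = gen i * (x - inv x) := by
      rw [map_mul, inv_gen, mul_sub, neg_mul, sub_eq_add_neg]
    have e2 : gen i * x - inv (gen i * x) = gen i * (x + inv x) := by
      rw [map_mul, inv_gen, mul_add, neg_mul, sub_neg_eq_add]
    rw [e1, e2]
    constructor
    · rw [mul_assoc, (hx y).2, ← mul_assoc, gen_mul, inv_inv, mul_assoc]
    · rw [mul_assoc, (hx y).1, ← mul_assoc, gen_mul, mul_assoc]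

theorem even_mul_comm {x : Gr L} (hx : inv x = x) (y : Gr L) : x * y = y * x := by
  have h := (graded_comm x y).1
  rw [hx, ← two_smul ℂ, smul_mul_assoc, mul_smul_comm] at h
  exact smul_right_injective _ (two_ne_zero (α := ℂ)) h

theorem odd_mul_comm {x : Gr L} (hx : inv x = -x) (y : Gr L) : x * y = inv y * x := by
  have h := (graded_comm x y).2
  rw [hx, sub_neg_eq_add, ← two_smul ℂ, smul_mul_assoc, mul_smul_comm] at h
  exact smul_right_injective _ (two_ne_zero (α := ℂ)) h

theorem dθ_mul (a : Fin 2) (x y : Gr L) : dθ a (x * y) = dθ a x * y + inv x * dθ a y :=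
  contract_mul _ _ _

theorem inv_dθ (a : Fin 2) (x : Gr L) : inv (dθ a x) = -dθ a (inv x) := inv_contract _ _

theorem dθ_one (a : Fin 2) : dθ a (1 : Gr L) = 0 := contract_one _

theorem dθ_dθ (a b : Fin 2) (x : Gr L) : dθ a (dθ b x) = -dθ b (dθ a x) := contract_contract _ _ _

theorem dθ_self (a : Fin 2) (x : Gr L) : dθ a (dθ a x) = 0 := contract_self _ _

theorem dθ_gen_mul (a : Fin 2) (i : Fin (2 + L)) (x : Gr L) :
    dθ a (gen i * x) = (if i = Fin.castAdd L a then x else 0) - gen i * dθ a x := by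
  rw [dθ_eq_contract, contract_gen_mul, Finsupp.lapply_apply, Finsupp.single_apply, ite_smul,
    one_smul, zero_smul]

theorem dθ_θ_mul (a b : Fin 2) (x : Gr L) :
    dθ a (θ b * x) = (if a = b then x else 0) - θ b * dθ a x := by
  rw [θ, dθ_gen_mul]
  simp only [(Fin.castAdd_injective 2 L).eq_iff, eq_comm]

theorem dθ_gen_natAdd_mul (a : Fin 2) (j : Fin L) (x : Gr L) :
    dθ a (gen (Fin.natAdd 2 j) * x) = - (gen (Fin.natAdd 2 j) * dθ a x) := by
  rw [dθ_gen_mul, if_neg, zero_sub]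
  intro h
  have := congrArg Fin.val h
  simp at this
  omega

theorem inv_θ (a : Fin 2) : inv (θ a : Gr L) = -θ a := inv_gen _

theorem θ_mul (a : Fin 2) (x : Gr L) : θ a * x = inv x * θ a := gen_mul _ _

theorem θ_mul_θ (a b : Fin 2) : (θ a * θ b : Gr L) = -(θ b * θ a) := gen_mul_gen _ _

theorem θ_mul_self (a : Fin 2) : (θ a * θ a : Gr L) = 0 := gen_mul_self _

theorem inv_restr (x : Gr L) : inv (restr x) = restr (inv x) := by
  induction x using gr_induction with
  | h1 => simp
  | hadd x x' hx hx' => simp only [map_add, hx, hx']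
  | hsmul c x hx => simp only [map_smul, hx]
  | hm i x hx =>
    simp only [map_mul, hx, inv_gen, map_neg]
    congr 1
    refine Fin.addCases (fun a => ?_) (fun j => ?_) i
    · rw [← θ, restr_θ]; simp
    · rw [restr_gen_natAdd]; simp

theorem inv_extend (h : L ≤ L') (x : Gr L) : inv (extend h x) = extend h (inv x) := by
  induction x using gr_induction with
  | h1 => simp
  | hadd x x' hx hx' => simp only [map_add, hx, hx']
  | hsmul c x hx => simp only [map_smul, hx]
  | hm i x hx => simp only [map_mul, hx, inv_gen, map_neg, extend_gen]

theorem dθ_extend (h : L ≤ L') (a : Fin 2) (x : Gr L) : dθ a (extend h x) = extend h (dθ a x) := by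
  induction x using gr_induction with
  | h1 => simp [dθ_one]
  | hadd x x' hx hx' => simp only [map_add, hx, hx']
  | hsmul c x hx => simp only [map_smul, hx]
  | hm i x hx =>
    rw [map_mul, extend_gen, dθ_gen_mul, dθ_gen_mul, hx, map_sub, map_mul, extend_gen,
      apply_ite (extend h),
      map_zero]
    congr 1
    refine if_congr ?_ rfl rfl
    simp [Fin.ext_iff]

theorem restr_extend (h : L ≤ L') (x : Gr L) : restr (extend h x) = extend h (restr x) := by
  induction x using gr_induction with
  | h1 => simp
  | hadd x x' hx hx' => simp only [map_add, hx, hx']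
  | hsmul c x hx => simp only [map_smul, hx]
  | hm i x hx =>
    simp only [map_mul, hx, extend_gen]
    congr 1
    refine Fin.addCases (fun a => ?_) (fun j => ?_) i
    · have e : Fin.castLE (Nat.add_le_add_left h 2) (Fin.castAdd L a) = Fin.castAdd L' a := rfl
      rw [e, ← θ, ← θ, restr_θ, restr_θ, map_zero]
    · have e : Fin.castLE (Nat.add_le_add_left h 2) (Fin.natAdd 2 j)
          = Fin.natAdd 2 (Fin.castLE h j) := rfl
      rw [e, restr_gen_natAdd, restr_gen_natAdd, extend_gen, e]

/-- A contraction that vanishes on the generators of the smaller algebra annihilates it. -/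
theorem contract_extend_eq_zero (h : L ≤ L') (d : Module.Dual ℂ (Fin (2 + L') →₀ ℂ))
    (hd : ∀ i : Fin (2 + L),
      d (Finsupp.single (Fin.castLE (Nat.add_le_add_left h 2) i) 1) = 0) (x : Gr L) :
    contract d (extend h x) = 0 := by
  induction x using gr_induction with
  | h1 => simp
  | hadd x x' hx hx' => simp only [map_add, hx, hx', add_zero]
  | hsmul c x hx => simp only [map_smul, hx, smul_zero]
  | hm i x hx => rw [map_mul, extend_gen, contract_gen_mul, hd, hx, zero_smul, mul_zero, sub_zero]

/-- The coefficient of `θ₁ θ₂`. -/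
noncomputable def berezin : Gr L →ₗ[ℂ] Gr L :=
  restr.toLinearMap ∘ₗ dθ 1 ∘ₗ dθ 0

theorem berezin_apply (x : Gr L) : berezin x = restr (dθ 1 (dθ 0 x)) := rfl

/-- The expansion in `θ₁, θ₂`. -/
theorem eq_components (x : Gr L) : x = restr x + θ 0 * restr (dθ 0 x) + θ 1 * restr (dθ 1 x)
    + θ 0 * θ 1 * berezin x := by
  induction x using gr_induction with
  | h1 => simp [dθ_one, berezin_apply]
  | hadd x y hx hy =>
    simp only [map_add, mul_add]
    nth_rw 1 [hx, hy]
    abel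
  | hsmul c x hx =>
    simp only [map_smul, mul_smul_comm]
    nth_rw 1 [hx]
    simp only [smul_add]
  | hm i x hx =>
    refine Fin.addCases (fun a => ?_) (fun j => ?_) i
    · rw [← θ]
      nth_rw 1 [hx]
      have h00 := θ_mul_self (L := L) 0
      have h11 := θ_mul_self (L := L) 1
      have h10 := θ_mul_θ (L := L) 1 0
      fin_cases a
      · simp [berezin_apply, dθ_θ_mul, restr_θ, mul_add, ← mul_assoc, h00]
      · simp [berezin_apply, dθ_θ_mul, restr_θ, mul_add, ← mul_assoc, h11, h10]
        simp [mul_assoc, h11]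
    · nth_rw 1 [hx]
      have e : ∀ a y, gen (Fin.natAdd 2 j) * (θ a * y)
          = -(θ a * (gen (Fin.natAdd 2 j) * y) : Gr L) :=
        fun a y => by rw [← mul_assoc, θ, gen_mul_gen, neg_mul, mul_assoc]
      simp only [berezin_apply, dθ_gen_natAdd_mul, map_mul, map_neg, restr_gen_natAdd, mul_add,
        mul_assoc, e, neg_neg, mul_neg]

theorem eq_zero_of_components {x : Gr L} (h : restr x = 0) (h0 : restr (dθ 0 x) = 0)
    (h1 : restr (dθ 1 x) = 0) (h01 : berezin x = 0) : x = 0 := by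
  rw [eq_components x, h, h0, h1, h01]; simp

end GrassmannAlgebra

/-! ### Calculus of Grassmann-valued functions and odd vector fields. -/

section Calculus

variable {L L' : ℕ} {E : Type*} [NormedAddCommGroup E] [NormedSpace ℝ E]

instance (L : ℕ) : CompleteSpace (Gr L) := FiniteDimensional.complete ℂ (Gr L)

/-- Multiplication as a continuous real bilinear map. -/
noncomputable def mulCLM (L : ℕ) : Gr L →L[ℝ] Gr L →L[ℝ] Gr L :=
  (LinearMap.mul ℝ (Gr L)).toContinuousBilinearMap

/-- A complex linear map as a continuous real linear map. -/
noncomputable def toCLM (T : Gr L →ₗ[ℂ] Gr L') : Gr L →L[ℝ] Gr L' :=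
  (T.restrictScalars ℝ).toContinuousLinearMap

theorem contDiffOn_mul {n : WithTop ℕ∞} {f g : E → Gr L} {S : Set E} (hf : ContDiffOn ℝ n f S)
    (hg : ContDiffOn ℝ n g S) : ContDiffOn ℝ n (fun z => f z * g z) S :=
  (mulCLM L).isBoundedBilinearMap.contDiff.comp_contDiffOn (hf.prodMk hg)

theorem contDiffOn_linear {n : WithTop ℕ∞} (T : Gr L →ₗ[ℂ] Gr L') {f : E → Gr L} {S : Set E}
    (hf : ContDiffOn ℝ n f S) : ContDiffOn ℝ n (fun z => T (f z)) S :=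
  (toCLM T).contDiff.comp_contDiffOn hf

/-- The derivative in the direction `v`. -/
noncomputable def pd (v : E) (f : E → Gr L) (z : E) : Gr L := fderiv ℝ f z v

theorem pd_mul (v : E) {f g : E → Gr L} {z : E} (hf : DifferentiableAt ℝ f z)
    (hg : DifferentiableAt ℝ g z) :
    pd v (fun w => f w * g w) z = pd v f z * g z + f z * pd v g z := by
  have h := (mulCLM L).hasFDerivAt_of_bilinear hf.hasFDerivAt hg.hasFDerivAt
  have h' : HasFDerivAt (fun w => f w * g w) _ z := h
  rw [pd, h'.fderiv, add_comm]
  rfl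

theorem pd_linear (v : E) (T : Gr L →ₗ[ℂ] Gr L') {f : E → Gr L} {z : E}
    (hf : DifferentiableAt ℝ f z) : pd v (fun w => T (f w)) z = T (pd v f z) := by
  have h : HasFDerivAt (fun w => T (f w)) _ z := (toCLM T).hasFDerivAt.comp z hf.hasFDerivAt
  rw [pd, h.fderiv]
  rfl

theorem pd_add (v : E) {f g : E → Gr L} {z : E} (hf : DifferentiableAt ℝ f z)
    (hg : DifferentiableAt ℝ g z) : pd v (fun w => f w + g w) z = pd v f z + pd v g z := by
  rw [pd, fderiv_fun_add hf hg]; rfl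

theorem pd_neg_dir (v : E) (f : E → Gr L) (z : E) : pd (-v) f z = -pd v f z := map_neg _ _

theorem pd_const (v : E) (c : Gr L) (z : E) : pd v (fun _ => c) z = 0 := by
  rw [pd, fderiv_fun_const]; rfl

theorem pd_congr {S : Set E} (hS : IsOpen S) {f g : E → Gr L} (h : Set.EqOn f g S) {z : E}
    (hz : z ∈ S) (v : E) : pd v f z = pd v g z := by
  rw [pd, pd, (h.eventuallyEq_of_mem (hS.mem_nhds hz)).fderiv_eq]

theorem contDiffOn_pd {S : Set E} (hS : IsOpen S) {f : E → Gr L} (hf : ContDiffOn ℝ ∞ f S)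
    (v : E) : ContDiffOn ℝ ∞ (pd v f) S :=
  (hf.fderiv_of_isOpen hS (by simp)).clm_apply contDiffOn_const

theorem differentiableAt_of_contDiffOn {F : Type*} [NormedAddCommGroup F] [NormedSpace ℝ F]
    {S : Set E} (hS : IsOpen S) {f : E → F} (hf : ContDiffOn ℝ ∞ f S)
    {z : E} (hz : z ∈ S) : DifferentiableAt ℝ f z :=
  (hf.contDiffAt (hS.mem_nhds hz)).differentiableAt (by simp)

theorem pd_comm {S : Set E} (hS : IsOpen S) {f : E → Gr L} (hf : ContDiffOn ℝ ∞ f S) {z : E}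
    (hz : z ∈ S) (v w : E) : pd v (pd w f) z = pd w (pd v f) z := by
  have h1 : DifferentiableAt ℝ (fderiv ℝ f) z :=
    differentiableAt_of_contDiffOn hS (hf.fderiv_of_isOpen hS (by simp)) hz
  have h2 : ∀ v w : E, pd v (pd w f) z = fderiv ℝ (fderiv ℝ f) z v w := by
    intro v w
    have h3 := h1.hasFDerivAt.clm_apply (hasFDerivAt_const w z)
    have h4 : HasFDerivAt (pd w f) _ z := h3
    rw [pd, h4.fderiv]
    simp
  rw [h2, h2]
  exact ((hf.contDiffAt (hS.mem_nhds hz)).isSymmSndFDerivAt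
    (by rw [minSmoothness_of_isRCLikeNormedField]
        exact WithTop.coe_le_coe.2 (le_top : (2 : ℕ∞) ≤ ⊤))).eq v w

/-- The odd vector field `∂/∂θ_a + θ₁ ∂_v + θ₂ ∂_w`. -/
noncomputable def sd (a : Fin 2) (v w : E) (f : E → Gr L) (z : E) : Gr L :=
  dθ a (f z) + θ 0 * pd v f z + θ 1 * pd w f z

variable {S : Set E} (hS : IsOpen S) (a : Fin 2) (v w : E) {f g : E → Gr L} {z : E}
include hS

theorem contDiffOn_sd (hf : ContDiffOn ℝ ∞ f S) : ContDiffOn ℝ ∞ (sd a v w f) S :=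
  ((contDiffOn_linear (dθ a) hf).add
    (contDiffOn_mul contDiffOn_const (contDiffOn_pd hS hf v))).add
    (contDiffOn_mul contDiffOn_const (contDiffOn_pd hS hf w))

theorem sd_congr (h : Set.EqOn f g S) (hz : z ∈ S) : sd a v w f z = sd a v w g z := by
  rw [sd, sd, pd_congr hS h hz, pd_congr hS h hz, h hz]

/-- The sign `inv (f z)` arises twice, consistently: from the graded Leibniz rule for ∂/∂θ, and from
moving θ₁, θ₂ past `f z`. -/
theorem sd_mul (hf : ContDiffOn ℝ ∞ f S) (hg : ContDiffOn ℝ ∞ g S) (hz : z ∈ S) :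
    sd a v w (fun y => f y * g y) z = sd a v w f z * g z + inv (f z) * sd a v w g z := by
  have hf' := differentiableAt_of_contDiffOn hS hf hz
  have hg' := differentiableAt_of_contDiffOn hS hg hz
  simp only [sd, pd_mul _ hf' hg', dθ_mul, mul_add, add_mul, ← mul_assoc, ← θ_mul]
  abel

theorem sd_add (hf : ContDiffOn ℝ ∞ f S) (hg : ContDiffOn ℝ ∞ g S) (hz : z ∈ S) :
    sd a v w (fun y => f y + g y) z = sd a v w f z + sd a v w g z := by
  have hf' := differentiableAt_of_contDiffOn hS hf hz
  have hg' := differentiableAt_of_contDiffOn hS hg hz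
  simp only [sd, pd_add _ hf' hg', map_add, mul_add]
  abel

theorem sd_sum {ι : Type*} (s : Finset ι) {f : ι → E → Gr L}
    (hf : ∀ i, ContDiffOn ℝ ∞ (f i) S) (hz : z ∈ S) :
    sd a v w (fun y => ∑ i ∈ s, f i y) z = ∑ i ∈ s, sd a v w (f i) z := by
  classical
  induction s using Finset.induction_on with
  | empty => simp [sd, pd_const]
  | insert i s hi ih =>
    simp only [Finset.sum_insert hi]
    rw [sd_add hS a v w (hf i) (ContDiffOn.sum fun i _ => hf i) hz, ih]

theorem sd_smul (c : ℂ) (hf : ContDiffOn ℝ ∞ f S) (hz : z ∈ S) :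
    sd a v w (fun y => c • f y) z = c • sd a v w f z := by
  have hf' := differentiableAt_of_contDiffOn hS hf hz
  have h := fun v => pd_linear v (c • LinearMap.id) hf'
  simp only [LinearMap.smul_apply, LinearMap.id_apply] at h
  simp only [sd, h, map_smul, mul_smul_comm, smul_add]

theorem sd_extend (h : L ≤ L') (hf : ContDiffOn ℝ ∞ f S) (hz : z ∈ S) :
    sd a v w (fun y => extend h (f y)) z = extend h (sd a v w f z) := by
  have hf' := differentiableAt_of_contDiffOn hS hf hz
  have h1 := fun v => pd_linear v (extend h).toLinearMap hf'
  simp only [AlgHom.toLinearMap_apply] at h1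
  simp only [sd, h1, map_add, map_mul, extend_θ, dθ_extend]

theorem pd_inv (hf : ContDiffOn ℝ ∞ f S) (hz : z ∈ S) :
    pd v (fun y => inv (f y)) z = inv (pd v f z) :=
  pd_linear v inv.toLinearMap (differentiableAt_of_contDiffOn hS hf hz)

theorem inv_pd_of_even (hf : ContDiffOn ℝ ∞ f S) (he : ∀ y ∈ S, inv (f y) = f y) (hz : z ∈ S) :
    inv (pd v f z) = pd v f z := by
  rw [← pd_inv hS v hf hz, pd_congr hS he hz]

theorem inv_sd_of_even (hf : ContDiffOn ℝ ∞ f S) (he : ∀ y ∈ S, inv (f y) = f y) (hz : z ∈ S) :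
    inv (sd a v w f z) = -sd a v w f z := by
  simp only [sd, map_add, map_mul, inv_pd_of_even hS _ hf he hz, inv_dθ, he z hz, inv_θ]
  simp only [neg_mul]
  abel

theorem pd_sd (u : E) (hf : ContDiffOn ℝ ∞ f S) (hz : z ∈ S) :
    pd u (sd a v w f) z = sd a v w (pd u f) z := by
  have h0 := differentiableAt_of_contDiffOn hS hf hz
  have h1 := fun v => differentiableAt_of_contDiffOn hS (contDiffOn_pd hS hf v) hz
  have h2 := fun (c : Gr L) v => differentiableAt_of_contDiffOn hS
    (contDiffOn_mul (f := fun _ => c) contDiffOn_const (contDiffOn_pd hS hf v)) hz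
  have h3 := differentiableAt_of_contDiffOn hS (contDiffOn_linear (dθ a) hf) hz
  have e : sd a v w f = fun y => (dθ a (f y) + θ 0 * pd v f y) + θ 1 * pd w f y := rfl
  rw [e, pd_add u (f := fun y => dθ a (f y) + θ 0 * pd v f y) (h3.fun_add (h2 _ _)) (h2 _ _),
    pd_add u h3 (h2 _ _),
    pd_mul u (differentiableAt_const _) (h1 _), pd_mul u (differentiableAt_const _) (h1 _),
    pd_linear u (dθ a) h0, pd_const, pd_const, zero_mul, zero_add, zero_mul, zero_add,
    pd_comm hS hf hz u v, pd_comm hS hf hz u w, sd]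

/-- The coefficients are linear in θ, so the anticommutator has constant coefficients. This yields
D₁² = -∂ₓ, D₂² = ∂ₓ and D₁D₂ + D₂D₁ = -2∂_y. -/
theorem sd_sd_add (hf : ContDiffOn ℝ ∞ f S) (hz : z ∈ S) (b : Fin 2) (v' w' : E) :
    sd a v w (sd b v' w' f) z + sd b v' w' (sd a v w f) z
      = (if a = 0 then pd v' f z else 0) + (if a = 1 then pd w' f z else 0)
        + ((if b = 0 then pd v f z else 0) + (if b = 1 then pd w f z else 0)) := by
  -- Exchanging the two fields reverses the sign of everything in this expansion except the
  -- undifferentiated-θ terms in the two `if` brackets.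
  have key : ∀ (a b : Fin 2) (v w v' w' : E), sd a v w (sd b v' w' f) z =
      dθ a (dθ b (f z)) + ((if a = 0 then pd v' f z else 0) + (if a = 1 then pd w' f z else 0))
      - (θ 0 * dθ a (pd v' f z) + θ 1 * dθ a (pd w' f z))
      + (θ 0 * dθ b (pd v f z) + θ 1 * dθ b (pd w f z))
      + θ 0 * θ 1 * (pd v (pd w' f) z - pd w (pd v' f) z) := by
    intro a b v w v' w'
    rw [sd, pd_sd hS b v' w' v hf hz, pd_sd hS b v' w' w hf hz]
    rw [pd_comm hS hf hz v w', pd_comm hS hf hz w v']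
    simp only [sd, map_add, dθ_θ_mul, mul_add, mul_sub, ← mul_assoc,
      θ_mul_self, θ_mul_θ 1 0, zero_mul, neg_mul]
    abel
  rw [key, key, dθ_dθ a b, pd_comm hS hf hz v' w, pd_comm hS hf hz w' v]
  simp only [mul_sub]
  abel

omit hS in
theorem restr_sd : restr (sd a v w f z) = restr (dθ a (f z)) := by
  simp [sd, restr_θ]

omit hS in
theorem restr_dθ_zero_sd :
    restr (dθ 0 (sd a v w f z)) = restr (dθ 0 (dθ a (f z))) + restr (pd v f z) := by
  simp [sd, dθ_θ_mul, restr_θ]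

omit hS in
theorem restr_dθ_one_sd :
    restr (dθ 1 (sd a v w f z)) = restr (dθ 1 (dθ a (f z))) + restr (pd w f z) := by
  simp [sd, dθ_θ_mul, restr_θ]

theorem pd_restr_dθ (hf : ContDiffOn ℝ ∞ f S) (hz : z ∈ S) :
    pd v (fun y => restr (dθ a (f y))) z = restr (dθ a (pd v f z)) :=
  pd_linear v (restr.toLinearMap ∘ₗ dθ a) (differentiableAt_of_contDiffOn hS hf hz)

/-- Odd vector fields act on the `θ₁ θ₂`-coefficient by a total derivative. -/
theorem berezin_sd (hf : ContDiffOn ℝ ∞ f S) (hz : z ∈ S) :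
    berezin (sd a v w f z) = pd v (fun y => restr (dθ 1 (f y))) z
      - pd w (fun y => restr (dθ 0 (f y))) z := by
  rw [pd_restr_dθ hS _ _ hf hz, pd_restr_dθ hS _ _ hf hz]
  -- There are only two θ's, so third θ-derivatives vanish.
  have h : ∀ a : Fin 2, dθ 1 (dθ 0 (dθ a (f z))) = 0 := by
    intro a
    fin_cases a
    · simp [dθ_self]
    · simp [dθ_dθ 0 1, dθ_self]
  simp [sd, berezin_apply, dθ_θ_mul, restr_θ, h, sub_eq_add_neg]

end Calculus

/-! ### The pairing, the curvature term and the algebra of the Lagrangian. -/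

section Pairing

variable {N L L' : ℕ}

theorem pair_add_left (v v' w : Vec N L) : pair (v + v') w = pair v w + pair v' w := by
  simp [pair, add_mul, Finset.sum_add_distrib]

theorem pair_add_right (v w w' : Vec N L) : pair v (w + w') = pair v w + pair v w' := by
  simp [pair, mul_add, Finset.sum_add_distrib]

theorem pair_neg_left (v w : Vec N L) : pair (-v) w = -pair v w := by
  simp [pair]

theorem pair_neg_right (v w : Vec N L) : pair v (-w) = -pair v w := by
  simp [pair]

theorem pair_sub_left (v v' w : Vec N L) : pair (v - v') w = pair v w - pair v' w := by
  simp [pair, sub_mul]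

theorem pair_sub_right (v w w' : Vec N L) : pair v (w - w') = pair v w - pair v w' := by
  simp [pair, mul_sub]

theorem pair_comm_of_even {v : Vec N L} (hv : ∀ i, inv (v i) = v i) (w : Vec N L) :
    pair v w = pair w v :=
  Finset.sum_congr rfl fun i _ => even_mul_comm (hv i) _

theorem pair_comm_of_odd {v w : Vec N L} (hv : ∀ i, inv (v i) = -v i)
    (hw : ∀ i, inv (w i) = -w i) : pair v w = -pair w v := by
  simp only [pair, ← Finset.sum_neg_distrib]
  refine Finset.sum_congr rfl fun i _ => ?_
  rw [odd_mul_comm (hv i), hw i, neg_mul]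

theorem pair_self_of_odd {v : Vec N L} (hv : ∀ i, inv (v i) = -v i) : pair v v = 0 := by
  have h := pair_comm_of_odd hv hv
  rw [eq_neg_iff_add_eq_zero, ← two_smul ℂ] at h
  exact (smul_eq_zero.1 h).resolve_left two_ne_zero

theorem pair_pr_right {u : Vec N L} (hu : ∀ i, inv (u i) = u i) (w v : Vec N L)
    (h : pair w u = 0) : pair w (pr u v) = pair w v := by
  have e : ∀ i, w i * pr u v i = w i * v i - w i * u i * pair v u := by
    intro i
    rw [pr, mul_sub, ← even_mul_comm (hu i), mul_assoc]
  simp only [pair, e, Finset.sum_sub_distrib, ← Finset.sum_mul]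
  rw [show ∑ i, w i * u i = pair w u from rfl, h, zero_mul, sub_zero]

theorem pair_pr_pr {u : Vec N L} (hu : ∀ i, inv (u i) = u i) (h : pair u u = 1) (v : Vec N L) :
    pair (pr u v) (pr u v) = pair v v - pair v u * pair v u := by
  have h1 : pair (pr u v) u = 0 := by
    have e : ∀ i, pr u v i * u i = v i * u i - pair v u * (u i * u i) := by
      intro i
      rw [pr, sub_mul, mul_assoc]
    rw [pair, Finset.sum_congr rfl fun i _ => e i, Finset.sum_sub_distrib, ← Finset.mul_sum]
    change pair v u - pair v u * pair u u = 0
    rw [h, mul_one, sub_self]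
  rw [pair_pr_right hu _ _ h1]
  have e : ∀ i, pr u v i * v i = v i * v i - pair v u * (v i * u i) := by
    intro i
    rw [pr, sub_mul, mul_assoc, even_mul_comm (hu i)]
  rw [pair, Finset.sum_congr rfl fun i _ => e i, Finset.sum_sub_distrib, ← Finset.mul_sum]
  rfl

/-- The minus sign of the curvature tensor becomes a plus because the odd factors `X i` and `Y j`
anticommute. -/
theorem pair_curv {X Y Z : Vec N L} (hX : ∀ i, inv (X i) = -X i) (hY : ∀ i, inv (Y i) = -Y i)
    (W : Vec N L) :
    pair W (curv X Y Z) = pair W X * pair Y Z + pair W Y * pair X Z := by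
  have e : ∀ l, curv X Y Z l = X l * pair Y Z + Y l * pair X Z := by
    intro l
    have h1 : ∀ i j k, (((if i = l then 1 else 0) * (if j = k then 1 else 0)
        - (if i = k then 1 else 0) * (if j = l then 1 else 0) : ℂ)) • (X i * Y j * Z k)
        = (if j = k then (if i = l then X i * Y j * Z k else 0) else 0)
          + (if i = k then (if j = l then Y j * X i * Z k else 0) else 0) := by
      intro i j k
      have h2 : X i * Y j = -(Y j * X i) := by rw [odd_mul_comm (hX i), hY, neg_mul]
      split_ifs <;> simp [h2]
    simp only [curv, h1, Finset.sum_add_distrib, Finset.sum_ite_eq, Finset.mem_univ, if_true]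
    congr 1
    · rw [Finset.sum_comm]
      simp [pair, Finset.mul_sum, mul_assoc]
    · simp [pair, Finset.mul_sum, mul_assoc]
  simp only [pair, e, mul_add, Finset.sum_add_distrib, ← mul_assoc, ← Finset.sum_mul]

/-- By `pair_curv` the sum splits in two: ε^{ab}ε^{cd}⟨ψ_a, ψ_b⟩⟨ψ_c, ψ_d⟩ contributes 4⟨s, t⟩² and
ε^{ab}ε^{cd}⟨ψ_a, ψ_c⟩⟨ψ_b, ψ_d⟩ contributes 2⟨s, t⟩². -/
theorem curvature_term {s t : Vec N L} (hs : ∀ i, inv (s i) = -s i) (ht : ∀ i, inv (t i) = -t i)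
    (ψ : Fin 2 → Vec N L) (h0 : ψ 0 = s) (h1 : ψ 1 = t) :
    (∑ a, ∑ b, ∑ c, ∑ d, (eps a b * eps c d) • pair (ψ a) (curv (ψ b) (ψ c) (ψ d)))
      = (6 : ℂ) • (pair s t * pair s t) := by
  have hts : pair t s = -pair s t := pair_comm_of_odd ht hs
  simp only [Fin.sum_univ_two, h0, h1, pair_curv hs hs, pair_curv hs ht, pair_curv ht hs,
    pair_curv ht ht, hts, pair_self_of_odd hs, pair_self_of_odd ht, eps]
  simp
  module

/-- The component form of the Lagrangian, compared with the `θ₁ θ₂`-coefficient of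
`⟨D₁Φ, D₂Φ⟩`. -/
theorem lagrangian_algebra {u s t F ux uy sx sy tx ty : Vec N L} (hu : ∀ i, inv (u i) = u i)
    (ht : ∀ i, inv (t i) = -t i) (htx : ∀ i, inv (tx i) = -tx i) (hsy : ∀ i, inv (sy i) = -sy i)
    (hF : ∀ i, inv (F i) = F i)
    (huu : pair u u = 1) (hsu : pair s u = 0) (htu : pair t u = 0) (hFu : pair F u = pair s t) :
    -((1 / 2 : ℂ) • (pair ux ux + pair uy uy))
      + (1 / 2 : ℂ) • (pair s (-pr u sx - pr u ty) - pair t (pr u sy - pr u tx))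
      + (1 / 12 : ℂ) • ((6 : ℂ) • (pair s t * pair s t))
      + (1 / 2 : ℂ) • pair (pr u F) (pr u F)
    = (1 / 2 : ℂ) • (pair (sy - tx) t + pair (-ux) ux - pair (F - uy) (-F - uy)
      + pair s (-sx - ty)) := by
  have h1 : pair sy t = -pair t sy := pair_comm_of_odd hsy ht
  have h2 : pair tx t = -pair t tx := pair_comm_of_odd htx ht
  have h3 : pair uy F = pair F uy := (pair_comm_of_even hF uy).symm
  -- The projections disappear against the tangent `s`, `t`. Also |pr(u)F|² = |F|² - ⟨s, t⟩², whose
  -- quartic part cancels the curvature contribution ½⟨s, t⟩².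
  simp only [pair_sub_right, pair_sub_left, pair_neg_left, pair_neg_right,
    pair_pr_right hu _ _ hsu, pair_pr_right hu _ _ htu, pair_pr_pr hu huu, hFu, h1, h2, h3]
  module

theorem berezin_even_mul {x : Gr L} (hx : inv x = x) (y : Gr L) :
    berezin (x * y) = berezin x * restr y - restr (dθ 0 x) * restr (dθ 1 y)
      + restr (dθ 1 x) * restr (dθ 0 y) + restr x * berezin y := by
  simp only [berezin_apply, dθ_mul, map_add, map_mul, hx, inv_dθ, map_neg, neg_mul]
  abel

theorem berezin_odd_mul {x : Gr L} (hx : inv x = -x) (y : Gr L) :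
    berezin (x * y) = berezin x * restr y + restr (dθ 0 x) * restr (dθ 1 y)
      - restr (dθ 1 x) * restr (dθ 0 y) + restr x * berezin y := by
  simp only [berezin_apply, dθ_mul, map_add, map_mul, hx, inv_dθ, map_neg, neg_mul, neg_neg]
  abel

/-- These are the coefficients of 1, θ_a and θ₁θ₂ in ⟨v, v⟩ = 1. The last two come out doubled, and
the factor 2 is cancelled. -/
theorem sphere_components {v : Vec N L} (hv : ∀ i, inv (v i) = v i) (h : pair v v = 1) :
    pair (fun i => restr (v i)) (fun i => restr (v i)) = 1 ∧
    (∀ a, pair (fun i => restr (dθ a (v i))) (fun i => restr (v i)) = 0) ∧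
    pair (fun i => berezin (v i)) (fun i => restr (v i))
      = pair (fun i => restr (dθ 0 (v i))) (fun i => restr (dθ 1 (v i))) := by
  have two : ∀ x : Gr L, (2 : ℂ) • x = 0 → x = 0 := fun x hx =>
    (smul_eq_zero.1 hx).resolve_left two_ne_zero
  have hr : ∀ i, inv (restr (v i)) = restr (v i) := fun i => by rw [inv_restr, hv]
  have hd : ∀ a i, inv (restr (dθ a (v i))) = -restr (dθ a (v i)) := fun a i => by
    rw [inv_restr, inv_dθ, hv, map_neg]
  refine ⟨?_, fun a => ?_, ?_⟩
  · have h1 := congrArg restr h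
    simpa [pair] using h1
  · have h1 := congrArg (fun x => restr (dθ a x)) h
    simp only [pair, map_sum, dθ_mul, dθ_one, map_zero, map_add, map_mul, hv] at h1
    simp only [fun i => even_mul_comm (hr i), ← two_smul ℂ, ← Finset.smul_sum] at h1
    exact two _ h1
  · have h1 := congrArg berezin h
    have hst := pair_comm_of_odd (hd 1) (hd 0)
    have hF := pair_comm_of_even hr (fun i => berezin (v i))
    rw [pair, map_sum, Finset.sum_congr rfl fun i _ => berezin_even_mul (hv i) _,
      Finset.sum_add_distrib, Finset.sum_add_distrib, Finset.sum_sub_distrib, berezin_apply 1,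
      dθ_one, map_zero, map_zero] at h1
    change pair _ _ - pair _ _ + pair _ _ + pair _ _ = 0 at h1
    rw [hst, hF] at h1
    rw [← sub_eq_zero]
    refine two _ ?_
    rw [two_smul, ← h1]
    abel

end Pairing

/-! ### The component Lagrangian as a superspace density. -/

section Superfields

variable {p N L L' : ℕ} {U : Set (Fin p → ℝ)}

/-- The coordinate direction `x`. -/
def eX (p : ℕ) : Pt p := ((1, 0), 0)

/-- The coordinate direction `y`. -/
def eY (p : ℕ) : Pt p := ((0, 1), 0)

theorem dx_eq_pd {f : Pt p → Gr L} {z : Pt p} (hf : DifferentiableAt ℝ f z) :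
    dx f z = pd (eX p) f z := by
  have h1 : HasDerivAt (fun s : ℝ => (((s, z.1.2), z.2) : Pt p)) (eX p) z.1.1 :=
    ((hasDerivAt_id _).prodMk (hasDerivAt_const _ _)).prodMk (hasDerivAt_const _ _)
  exact (hf.hasFDerivAt.comp_hasDerivAt z.1.1 h1).deriv

theorem dy_eq_pd {f : Pt p → Gr L} {z : Pt p} (hf : DifferentiableAt ℝ f z) :
    dy f z = pd (eY p) f z := by
  have h1 : HasDerivAt (fun s : ℝ => (((z.1.1, s), z.2) : Pt p)) (eY p) z.1.2 :=
    ((hasDerivAt_const _ _).prodMk (hasDerivAt_id _)).prodMk (hasDerivAt_const _ _)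
  exact (hf.hasFDerivAt.comp_hasDerivAt z.1.2 h1).deriv

theorem D₁_eq_sd {f : Pt p → Gr L} {z : Pt p} (hf : DifferentiableAt ℝ f z) :
    D₁ f z = sd 0 (-eX p) (-eY p) f z := by
  simp only [D₁, sd, dx_eq_pd hf, dy_eq_pd hf, pd_neg_dir]
  simp only [mul_neg, sub_eq_add_neg]

theorem D₂_eq_sd {f : Pt p → Gr L} {z : Pt p} (hf : DifferentiableAt ℝ f z) :
    D₂ f z = sd 1 (-eY p) (eX p) f z := by
  simp only [D₂, sd, dx_eq_pd hf, dy_eq_pd hf, pd_neg_dir]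
  simp only [mul_neg, sub_eq_add_neg]

theorem isOpen_univ_prod (hU : IsOpen U) : IsOpen (Set.univ ×ˢ U : Set (Pt p)) :=
  isOpen_univ.prod hU

theorem IsSuperfield.smooth_apply {Φ : Pt p → Vec N L} (hΦ : IsSuperfield U Φ) (i : Fin N) :
    ContDiffOn ℝ ∞ (fun z => Φ z i) (Set.univ ×ˢ U) :=
  contDiffOn_pi.1 hΦ.smooth i

theorem IsSuperfield.inv_apply {Φ : Pt p → Vec N L} (hΦ : IsSuperfield U Φ) (i : Fin N) :
    ∀ z ∈ Set.univ ×ˢ U, inv (Φ z i) = Φ z i :=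
  fun z hz => mem_evenPart.1 (hΦ.even z hz i)

/-- The superspace Lagrangian of a superfield with values in the sphere. -/
theorem lagrangian_eq_berezin (hU : IsOpen U) {Φ : Pt p → Vec N L} (hΦ : IsSphereSuperfield U Φ)
    {z : Pt p} (hz : z ∈ Set.univ ×ˢ U) :
    lagrangian Φ z = (1 / 2 : ℂ) • berezin (∑ i, sd 0 (-eX p) (-eY p) (fun w => Φ w i) z
      * sd 1 (-eY p) (eX p) (fun w => Φ w i) z) := by
  have hS := isOpen_univ_prod hU
  have hf := hΦ.smooth_apply
  have he := hΦ.inv_apply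
  have hd := fun i => differentiableAt_of_contDiffOn hS (hf i) hz
  obtain ⟨huu, hψu, hFu⟩ := sphere_components (fun i => he i z hz) (hΦ.sphere z hz)
  have hdψ : ∀ a v i, inv (restr (dθ a (pd v (fun w => Φ w i) z)))
      = -restr (dθ a (pd v (fun w => Φ w i) z)) := fun a v i => by
    rw [inv_restr, inv_dθ, inv_pd_of_even hS v (hf i) (he i) hz, map_neg]
  have hψ : ∀ a i, inv (restr (dθ a (Φ z i))) = -restr (dθ a (Φ z i)) := fun a i => by
    rw [inv_restr, inv_dθ, he i z hz, map_neg]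
  have hu : ∀ i, inv (restr (Φ z i)) = restr (Φ z i) := fun i => by rw [inv_restr, he i z hz]
  have hF : ∀ i, inv (berezin (Φ z i)) = berezin (Φ z i) := fun i => by
    rw [berezin_apply, inv_restr, inv_dθ, inv_dθ, he i z hz]; simp
  have key := lagrangian_algebra (ux := fun i => restr (pd (eX p) (fun w => Φ w i) z))
    (uy := fun i => restr (pd (eY p) (fun w => Φ w i) z))
    (sx := fun i => restr (dθ 0 (pd (eX p) (fun w => Φ w i) z)))
    (sy := fun i => restr (dθ 0 (pd (eY p) (fun w => Φ w i) z)))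
    (tx := fun i => restr (dθ 1 (pd (eX p) (fun w => Φ w i) z)))
    (ty := fun i => restr (dθ 1 (pd (eY p) (fun w => Φ w i) z)))
    hu (hψ 1) (hdψ 1 _) (hdψ 0 _) hF huu (hψu 0) (hψu 1) hFu
  rw [lagrangian, curvature_term (hψ 0) (hψ 1) (fun a => compψ Φ a z) rfl rfl]
  have eux : coordwise dx (compU Φ) z = fun i => restr (pd (eX p) (fun w => Φ w i) z) := by
    funext i
    have := pd_linear (eX p) restr.toLinearMap (hd i)
    exact (dx_eq_pd ((toCLM restr.toLinearMap).differentiableAt.comp z (hd i))).trans this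
  have euy : coordwise dy (compU Φ) z = fun i => restr (pd (eY p) (fun w => Φ w i) z) := by
    funext i
    have := pd_linear (eY p) restr.toLinearMap (hd i)
    exact (dy_eq_pd ((toCLM restr.toLinearMap).differentiableAt.comp z (hd i))).trans this
  have eψx : ∀ a, coordwise dx (compψ Φ a) z
      = fun i => restr (dθ a (pd (eX p) (fun w => Φ w i) z)) := by
    intro a; funext i
    have := pd_linear (eX p) (restr.toLinearMap ∘ₗ dθ a) (hd i)
    exact (dx_eq_pd ((toCLM (restr.toLinearMap ∘ₗ dθ a)).differentiableAt.comp z (hd i))).trans this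
  have eψy : ∀ a, coordwise dy (compψ Φ a) z
      = fun i => restr (dθ a (pd (eY p) (fun w => Φ w i) z)) := by
    intro a; funext i
    have := pd_linear (eY p) (restr.toLinearMap ∘ₗ dθ a) (hd i)
    exact (dy_eq_pd ((toCLM (restr.toLinearMap ∘ₗ dθ a)).differentiableAt.comp z (hd i))).trans this
  have e1 : dirac Φ z 1 = -nablaX Φ 0 z - nablaY Φ 1 z := rfl
  have e0 : dirac Φ z 0 = nablaY Φ 0 z - nablaX Φ 1 z := rfl
  rw [e1, e0, nablaX, nablaX, nablaY, nablaY, eux, euy, eψx, eψx, eψy, eψy]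
  refine Eq.trans key ?_
  congr 1
  have hodd : ∀ i, inv (sd 0 (-eX p) (-eY p) (fun w => Φ w i) z) = _ :=
    fun i => inv_sd_of_even hS 0 _ _ (hf i) (he i) hz
  rw [map_sum, Finset.sum_congr rfl fun i _ => berezin_odd_mul (hodd i) _]
  simp only [berezin_sd hS _ _ _ (hf _) hz, pd_restr_dθ hS _ _ (hf _) hz, restr_sd,
    restr_dθ_zero_sd, restr_dθ_one_sd, dθ_self, pd_neg_dir, map_neg, map_zero, zero_add,
    Finset.sum_add_distrib, Finset.sum_sub_distrib]
  simp only [pair, ← berezin_apply, dθ_dθ 0 1, map_neg, Pi.sub_apply, Pi.neg_apply]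
  simp only [sub_eq_add_neg, neg_neg, Finset.sum_add_distrib, add_mul, mul_add,
    Finset.sum_neg_distrib, neg_mul, mul_neg]
  abel

end Superfields

/-! ### The field equation in terms of D₁ and D₂. -/

section FieldEquation

variable {p N L L' : ℕ} {U : Set (Fin p → ℝ)}

/-- The vector field `D₁`, written with Fréchet derivatives. -/
noncomputable def Q₁ (f : Pt p → Gr L) : Pt p → Gr L := sd 0 (-eX p) (-eY p) f

/-- The vector field `D₂`, written with Fréchet derivatives. -/
noncomputable def Q₂ (f : Pt p → Gr L) : Pt p → Gr L := sd 1 (-eY p) (eX p) f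

/-- The operator `D₁ D₂ + ∂_y = (D₁ D₂ - D₂ D₁) / 2`. -/
noncomputable def superLaplacian (f : Pt p → Gr L) (z : Pt p) : Gr L :=
  Q₁ (Q₂ f) z + pd (eY p) f z

/-- The density `⟨D₁Φ, D₂Φ⟩`. -/
noncomputable def density (Φ : Pt p → Vec N L) (z : Pt p) : Gr L :=
  ∑ i, Q₁ (fun w => Φ w i) z * Q₂ (fun w => Φ w i) z

section

variable (hU : IsOpen U) {f : Pt p → Gr L} (hf : ContDiffOn ℝ ∞ f (Set.univ ×ˢ U)) {z : Pt p}
  (hz : z ∈ Set.univ ×ˢ U)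
include hU hf

theorem contDiffOn_Q₁ : ContDiffOn ℝ ∞ (Q₁ f) (Set.univ ×ˢ U) :=
  contDiffOn_sd (isOpen_univ_prod hU) _ _ _ hf

theorem contDiffOn_Q₂ : ContDiffOn ℝ ∞ (Q₂ f) (Set.univ ×ˢ U) :=
  contDiffOn_sd (isOpen_univ_prod hU) _ _ _ hf

theorem contDiffOn_superLaplacian : ContDiffOn ℝ ∞ (superLaplacian f) (Set.univ ×ˢ U) :=
  (contDiffOn_Q₁ hU (contDiffOn_Q₂ hU hf)).add (contDiffOn_pd (isOpen_univ_prod hU) hf _)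

include hz

theorem D_eq : D f z = (1 / 2 : ℂ) • (Q₁ f z + (-Complex.I) • Q₂ f z) := by
  have hd := differentiableAt_of_contDiffOn (isOpen_univ_prod hU) hf hz
  rw [D, D₁_eq_sd hd, D₂_eq_sd hd, neg_smul, ← sub_eq_add_neg]
  rfl

theorem Dbar_eq : Dbar f z = (1 / 2 : ℂ) • (Q₁ f z + Complex.I • Q₂ f z) := by
  have hd := differentiableAt_of_contDiffOn (isOpen_univ_prod hU) hf hz
  rw [Dbar, D₁_eq_sd hd, D₂_eq_sd hd]
  rfl

theorem Q₁_Q₁ : Q₁ (Q₁ f) z = -pd (eX p) f z := by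
  have h := sd_sd_add (isOpen_univ_prod hU) 0 (-eX p) (-eY p) hf hz 0 (-eX p) (-eY p)
  simp only [if_true, if_neg zero_ne_one, add_zero, ← two_smul ℂ, pd_neg_dir] at h
  exact smul_right_injective _ (two_ne_zero (α := ℂ)) h

theorem Q₂_Q₂ : Q₂ (Q₂ f) z = pd (eX p) f z := by
  have h := sd_sd_add (isOpen_univ_prod hU) 1 (-eY p) (eX p) hf hz 1 (-eY p) (eX p)
  simp only [if_true, if_neg one_ne_zero, zero_add, ← two_smul ℂ] at h
  exact smul_right_injective _ (two_ne_zero (α := ℂ)) h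

theorem Q₂_Q₁ : Q₂ (Q₁ f) z = -Q₁ (Q₂ f) z - (2 : ℂ) • pd (eY p) f z := by
  have h := sd_sd_add (isOpen_univ_prod hU) 1 (-eY p) (eX p) hf hz 0 (-eX p) (-eY p)
  simp only [if_true, if_neg one_ne_zero, if_neg zero_ne_one, zero_add, add_zero, pd_neg_dir] at h
  change Q₂ (Q₁ f) z + Q₁ (Q₂ f) z = _ at h
  rw [eq_sub_of_add_eq h]
  module

/-- Expand ¼(D₁ + iD₂)(D₁ - iD₂): the squares cancel since D₁² = -D₂², leaving -(i/4)(D₁D₂ - D₂D₁).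
-/
theorem Dbar_D : Dbar (D f) z = (-Complex.I / 2) • superLaplacian f z := by
  have hS := isOpen_univ_prod hU
  have h1 := contDiffOn_Q₁ hU hf
  have h2 := contDiffOn_Q₂ hU hf
  have h3 : ContDiffOn ℝ ∞ (fun y => (-Complex.I) • Q₂ f y) (Set.univ ×ˢ U) :=
    contDiffOn_linear ((-Complex.I) • LinearMap.id) h2
  have h4 : ContDiffOn ℝ ∞ (fun y => (1 / 2 : ℂ) • (Q₁ f y + (-Complex.I) • Q₂ f y))
      (Set.univ ×ˢ U) := contDiffOn_linear ((1 / 2 : ℂ) • LinearMap.id) (h1.add h3)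
  have e : Set.EqOn (D f) (fun y => (1 / 2 : ℂ) • (Q₁ f y + (-Complex.I) • Q₂ f y))
      (Set.univ ×ˢ U) := fun y hy => D_eq hU hf hy
  have key : ∀ (a : Fin 2) (v w : Pt p), sd a v w (D f) z
      = (1 / 2 : ℂ) • (sd a v w (Q₁ f) z + (-Complex.I) • sd a v w (Q₂ f) z) := by
    intro a v w
    rw [sd_congr hS a v w e hz, sd_smul hS a v w _ (h1.add h3) hz, sd_add hS a v w h1 h3 hz,
      sd_smul hS a v w _ h2 hz]
  rw [Dbar_eq hU (h4.congr e) hz, Q₁, Q₂, key, key]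
  change (1 / 2 : ℂ) • ((1 / 2 : ℂ) • (Q₁ (Q₁ f) z + (-Complex.I) • Q₁ (Q₂ f) z)
    + Complex.I • (1 / 2 : ℂ) • (Q₂ (Q₁ f) z + (-Complex.I) • Q₂ (Q₂ f) z)) = _
  rw [Q₁_Q₁ hU hf hz, Q₂_Q₂ hU hf hz, Q₂_Q₁ hU hf hz, superLaplacian]
  have hI : Complex.I • (1 / 2 : ℂ) • (-Complex.I) • pd (eX p) f z
      = (1 / 2 : ℂ) • pd (eX p) f z := by
    rw [smul_smul, smul_smul]
    congr 1
    linear_combination (-1 / 2 : ℂ) * Complex.I_mul_I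
  simp only [smul_add] at hI ⊢
  rw [hI]
  module

end

variable (hU : IsOpen U) {Φ : Pt p → Vec N L}
include hU

theorem inv_Q₁ (hΦ : IsSuperfield U Φ) {z : Pt p} (hz : z ∈ Set.univ ×ˢ U) (i : Fin N) :
    inv (Q₁ (fun w => Φ w i) z) = -Q₁ (fun w => Φ w i) z :=
  inv_sd_of_even (isOpen_univ_prod hU) _ _ _ (hΦ.smooth_apply i) (hΦ.inv_apply i) hz

theorem inv_Q₂ (hΦ : IsSuperfield U Φ) {z : Pt p} (hz : z ∈ Set.univ ×ˢ U) (i : Fin N) :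
    inv (Q₂ (fun w => Φ w i) z) = -Q₂ (fun w => Φ w i) z :=
  inv_sd_of_even (isOpen_univ_prod hU) _ _ _ (hΦ.smooth_apply i) (hΦ.inv_apply i) hz

/-- In ¼⟨A + iB, A - iB⟩ with odd A, B, the diagonal terms vanish and the two mixed terms coincide.
-/
theorem pair_Dbar_D (hΦ : IsSuperfield U Φ) {z : Pt p} (hz : z ∈ Set.univ ×ˢ U) :
    pair (coordwise Dbar Φ z) (coordwise D Φ z) = (-Complex.I / 2) • density Φ z := by
  let A : Vec N L := fun i => Q₁ (fun w => Φ w i) z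
  let B : Vec N L := fun i => Q₂ (fun w => Φ w i) z
  have hA : ∀ i, inv (A i) = -A i := inv_Q₁ hU hΦ hz
  have hB : ∀ i, inv (B i) = -B i := inv_Q₂ hU hΦ hz
  have e1 : coordwise Dbar Φ z = (1 / 2 : ℂ) • (A + Complex.I • B) := by
    funext i; exact Dbar_eq hU (hΦ.smooth_apply i) hz
  have e2 : coordwise D Φ z = (1 / 2 : ℂ) • (A + (-Complex.I) • B) := by
    funext i; exact D_eq hU (hΦ.smooth_apply i) hz
  have hl : ∀ (c : ℂ) (v w : Vec N L), pair (c • v) w = c • pair v w := fun c v w => by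
    simp [pair, Finset.smul_sum]
  have hr : ∀ (c : ℂ) (v w : Vec N L), pair v (c • w) = c • pair v w := fun c v w => by
    simp [pair, Finset.smul_sum]
  have e3 : density Φ z = pair A B := rfl
  rw [e1, e2, e3]
  simp only [hl, hr, pair_add_left, pair_add_right, pair_self_of_odd hA, pair_self_of_odd hB,
    pair_comm_of_odd hB hA, smul_zero]
  module

/-- Applying D₂ to |Φ|² = 1 gives ⟨Φ, D₂Φ⟩ = 0, and D₁ of this gives ⟨D₁Φ, D₂Φ⟩ + ⟨Φ, D₁D₂Φ⟩ = 0.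
The extra term ⟨Φ, ∂_yΦ⟩ vanishes for the same reason. -/
theorem sum_mul_superLaplacian (hΦ : IsSphereSuperfield U Φ) {z : Pt p}
    (hz : z ∈ Set.univ ×ˢ U) :
    ∑ i, Φ z i * superLaplacian (fun w => Φ w i) z = -density Φ z := by
  have hS := isOpen_univ_prod hU
  have hf := hΦ.smooth_apply
  have he := hΦ.inv_apply
  have two : ∀ x : Gr L, (2 : ℂ) • x = 0 → x = 0 := fun x hx =>
    (smul_eq_zero.1 hx).resolve_left two_ne_zero
  have h1 : Set.EqOn (fun w => ∑ i, Φ w i * Φ w i) (fun _ => 1) (Set.univ ×ˢ U) := hΦ.sphere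
  have hm : ∀ i, ContDiffOn ℝ ∞ (fun w => Φ w i * Φ w i) (Set.univ ×ˢ U) := fun i =>
    contDiffOn_mul (hf i) (hf i)
  have h2 : ∀ y ∈ Set.univ ×ˢ U, ∑ i, Φ y i * Q₂ (fun w => Φ w i) y = 0 := by
    intro y hy
    have h := sd_congr hS 1 (-eY p) (eX p) h1 hy
    rw [sd_sum hS _ _ _ _ hm hy, Finset.sum_congr rfl fun i _ =>
      sd_mul hS 1 (-eY p) (eX p) (hf i) (hf i) hy] at h
    simp only [he _ y hy, ← even_mul_comm (he _ y hy), ← two_smul ℂ, ← Finset.smul_sum] at h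
    refine two _ (h.trans ?_)
    simp [sd, pd_const, dθ_one]
  have h3 : ∑ i, Φ z i * pd (eY p) (fun w => Φ w i) z = 0 := by
    have h := pd_congr hS h1 hz (eY p)
    have hd := fun i => differentiableAt_of_contDiffOn hS (hf i) hz
    have hmd := fun i => differentiableAt_of_contDiffOn hS (hm i) hz
    have hs : pd (eY p) (fun w => ∑ i, Φ w i * Φ w i) z
        = ∑ i, pd (eY p) (fun w => Φ w i * Φ w i) z := by
      rw [pd, fderiv_fun_sum fun i _ => hmd i]
      simp [pd]
    rw [hs, pd_const, Finset.sum_congr rfl fun i _ => pd_mul (eY p) (hd i) (hd i)] at h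
    simp only [← even_mul_comm (he _ z hz), ← two_smul ℂ, ← Finset.smul_sum] at h
    exact two _ h
  have h4 := sd_congr hS 0 (-eX p) (-eY p) (g := fun _ => 0) h2 hz
  rw [sd_sum hS _ _ _ _ (fun i => contDiffOn_mul (hf i) (contDiffOn_Q₂ hU (hf i))) hz,
    Finset.sum_congr rfl fun i _ =>
      sd_mul hS 0 (-eX p) (-eY p) (hf i) (contDiffOn_Q₂ hU (hf i)) hz,
    Finset.sum_add_distrib] at h4
  simp only [he _ z hz] at h4
  have h5 : sd 0 (-eX p) (-eY p) (fun _ => (0 : Gr L)) z = 0 := by simp [sd, pd_const]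
  rw [h5] at h4
  change density Φ z + ∑ i, Φ z i * Q₁ (Q₂ fun w => Φ w i) z = 0 at h4
  simp only [superLaplacian, mul_add, Finset.sum_add_distrib, h3, add_zero]
  exact eq_neg_of_add_eq_zero_right h4

/-- The equation `D̄DΦ + ⟨D̄Φ, DΦ⟩Φ = 0` in real form. -/
theorem fieldEquation_iff (hΦ : IsSuperfield U Φ) {z : Pt p} (hz : z ∈ Set.univ ×ˢ U)
    (i : Fin N) :
    coordwise Dbar (coordwise D Φ) z i
        + pair (coordwise Dbar Φ z) (coordwise D Φ z) * Φ z i = 0 ↔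
      superLaplacian (fun w => Φ w i) z + density Φ z * Φ z i = 0 := by
  have e : coordwise Dbar (coordwise D Φ) z i = _ := Dbar_D hU (hΦ.smooth_apply i) hz
  rw [e, pair_Dbar_D hU hΦ hz, smul_mul_assoc, ← smul_add, smul_eq_zero]
  simp

end FieldEquation

/-! ### Integrals over a compact set: divergences and differentiation in a parameter. -/

section Integrals

open MeasureTheory

variable {F : Type*} [NormedAddCommGroup F] [NormedSpace ℝ F] {K : Set (ℝ × ℝ)}

theorem setIntegral_fderiv_eq_zero {g : ℝ × ℝ → F} (hg : ContDiff ℝ ∞ g) (hK : IsCompact K)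
    (h0 : ∀ ζ ∉ K, g ζ = 0) (v : ℝ × ℝ) : ∫ ζ in K, fderiv ℝ g ζ v = 0 := by
  have hc : HasCompactSupport g := HasCompactSupport.intro hK h0
  have hz : ∀ ζ ∉ K, fderiv ℝ g ζ v = 0 := by
    intro ζ hζ
    have h : g =ᶠ[nhds ζ] fun _ => 0 :=
      Filter.eventually_of_mem (hK.isClosed.isOpen_compl.mem_nhds hζ) h0
    rw [h.fderiv_eq, fderiv_fun_const]
    rfl
  have hd : Continuous fun ζ => fderiv ℝ g ζ v :=
    (hg.continuous_fderiv (by simp)).clm_apply continuous_const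
  have hdi : Integrable fun ζ => fderiv ℝ g ζ v :=
    hd.integrable_of_hasCompactSupport (HasCompactSupport.intro hK hz)
  have hgi : Integrable g := hg.continuous.integrable_of_hasCompactSupport hc
  rw [setIntegral_eq_integral_of_forall_compl_eq_zero hz]
  -- Integration by parts against the constant function 1.
  have h := integral_smul_fderiv_eq_neg_fderiv_smul_of_integrable (𝕜 := ℝ) (μ := volume)
    (f := fun _ : ℝ × ℝ => (1 : ℝ)) (g := g) (v := v) (by simp) (by simpa using hdi)
    (by simpa using hgi) (fun x _ => differentiableAt_const _)
    (fun x _ => hg.differentiable (by simp) x)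
  simpa using h

theorem hasDerivAt_setIntegral {g : ℝ × (ℝ × ℝ) → F} (hg : ContDiff ℝ ∞ g) (hK : IsCompact K) :
    HasDerivAt (fun t => ∫ ζ in K, g (t, ζ)) (∫ ζ in K, fderiv ℝ g (0, ζ) (1, 0)) 0 := by
  have hd : Continuous fun q => fderiv ℝ g q (1, 0) :=
    (hg.continuous_fderiv (by simp)).clm_apply continuous_const
  obtain ⟨C, hC⟩ := ((isCompact_Icc (a := (-1 : ℝ)) (b := 1)).prod hK).exists_bound_of_continuousOn
    hd.continuousOn
  have hs : ∀ t : ℝ, Continuous fun ζ : ℝ × ℝ => (t, ζ) := fun t => by fun_prop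
  refine (hasDerivAt_integral_of_dominated_loc_of_deriv_le (μ := volume.restrict K)
    (F := fun t ζ => g (t, ζ)) (F' := fun t ζ => fderiv ℝ g (t, ζ) (1, 0)) (x₀ := (0 : ℝ))
    (s := Set.Icc (-1) 1) (bound := fun _ => C) (Icc_mem_nhds (by norm_num) (by norm_num))
    (Filter.Eventually.of_forall fun t => ?_) ?_ ?_ ?_ ?_ ?_).2
  · exact (hg.continuous.comp (hs t)).aestronglyMeasurable
  · exact (hg.continuous.comp (hs 0)).continuousOn.integrableOn_compact hK
  · exact (hd.comp (hs 0)).aestronglyMeasurable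
  · exact (ae_restrict_mem hK.measurableSet).mono fun ζ hζ t ht => hC (t, ζ) ⟨ht, hζ⟩
  · have : IsFiniteMeasure (volume.restrict K) := ⟨by simpa using hK.measure_lt_top⟩
    exact integrable_const C
  · refine Filter.Eventually.of_forall fun ζ t _ => ?_
    have h1 : HasDerivAt (fun t : ℝ => (t, ζ)) ((1 : ℝ), (0 : ℝ × ℝ)) t :=
      (hasDerivAt_id t).prodMk (hasDerivAt_const t ζ)
    exact ((hg.differentiable (by simp)) (t, ζ)).hasFDerivAt.comp_hasDerivAt t h1

end Integrals

/-! ### The same integrals at a fixed even parameter `b`. -/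

section Slices

open MeasureTheory

variable {p L : ℕ} {U : Set (Fin p → ℝ)} {K : Set (ℝ × ℝ)} {b : Fin p → ℝ}

theorem contDiff_slice {f : Pt p → Gr L} (hf : ContDiffOn ℝ ∞ f (Set.univ ×ˢ U)) (hb : b ∈ U) :
    ContDiff ℝ ∞ fun ζ : ℝ × ℝ => f (ζ, b) := by
  rw [← contDiffOn_univ]
  exact hf.comp (by fun_prop) fun ζ _ => ⟨trivial, hb⟩

theorem integrableOn_slice {f : Pt p → Gr L} (hf : ContDiffOn ℝ ∞ f (Set.univ ×ˢ U)) (hb : b ∈ U)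
    (hK : IsCompact K) : IntegrableOn (fun ζ : ℝ × ℝ => f (ζ, b)) K :=
  (contDiff_slice hf hb).continuous.continuousOn.integrableOn_compact hK

theorem setIntegral_pd_eq_zero (hU : IsOpen U) {f : Pt p → Gr L}
    (hf : ContDiffOn ℝ ∞ f (Set.univ ×ˢ U)) (hb : b ∈ U) (hK : IsCompact K)
    (h0 : ∀ z ∈ Kᶜ ×ˢ U, f z = 0) (v : ℝ × ℝ) : ∫ ζ in K, pd (v, 0) f (ζ, b) = 0 := by
  rw [← setIntegral_fderiv_eq_zero (contDiff_slice hf hb) hK (fun ζ hζ => h0 (ζ, b) ⟨hζ, hb⟩) v]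
  refine setIntegral_congr_fun hK.measurableSet fun ζ _ => ?_
  have h1 : HasFDerivAt (fun ζ : ℝ × ℝ => ((ζ, b) : Pt p))
    (ContinuousLinearMap.inl ℝ (ℝ × ℝ) (Fin p → ℝ)) ζ := hasFDerivAt_prodMk_left ζ b
  have h2 := (differentiableAt_of_contDiffOn (isOpen_univ_prod hU) hf
    (z := (ζ, b)) ⟨trivial, hb⟩).hasFDerivAt.comp ζ h1
  have h3 : HasFDerivAt (fun ζ : ℝ × ℝ => f (ζ, b)) _ ζ := h2
  simp only [pd, h3.fderiv]
  rfl

/-- By `berezin_sd` the integrand is a divergence. The directions have zero component along the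
parameter space, so it is a divergence within the slice at `b`. -/
theorem setIntegral_berezin_sd (hU : IsOpen U) {f : Pt p → Gr L}
    (hf : ContDiffOn ℝ ∞ f (Set.univ ×ˢ U)) (hb : b ∈ U) (hK : IsCompact K)
    (h0 : ∀ z ∈ Kᶜ ×ˢ U, f z = 0) (a : Fin 2) (v w : ℝ × ℝ) :
    ∫ ζ in K, berezin (sd a (v, 0) (w, 0) f (ζ, b)) = 0 := by
  have hS := isOpen_univ_prod hU
  have hc : ∀ a, ContDiffOn ℝ ∞ (fun y => restr (dθ a (f y))) (Set.univ ×ˢ U) := fun a =>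
    contDiffOn_linear (restr.toLinearMap ∘ₗ dθ a) hf
  have hz : ∀ a, ∀ z ∈ Kᶜ ×ˢ U, restr (dθ a (f z)) = 0 := fun a z hz => by
    rw [h0 z hz, map_zero, map_zero]
  rw [setIntegral_congr_fun hK.measurableSet fun ζ _ =>
    berezin_sd hS a (v, 0) (w, 0) hf (z := (ζ, b)) ⟨trivial, hb⟩, integral_sub
    (integrableOn_slice (contDiffOn_pd hS (hc 1) _) hb hK)
    (integrableOn_slice (contDiffOn_pd hS (hc 0) _) hb hK),
    setIntegral_pd_eq_zero hU (hc 1) hb hK (hz 1), setIntegral_pd_eq_zero hU (hc 0) hb hK (hz 0),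
    sub_zero]

theorem hasDerivAt_setIntegral_slice {g : ℝ × Pt p → Gr L} (hU : IsOpen U)
    (hg : ContDiffOn ℝ ∞ g (Set.univ ×ˢ (Set.univ ×ˢ U))) (hb : b ∈ U) (hK : IsCompact K) :
    HasDerivAt (fun t => ∫ ζ in K, g (t, (ζ, b))) (∫ ζ in K, pd (1, 0) g (0, (ζ, b))) 0 := by
  have h0 : ContDiffOn ℝ ∞ (fun q : ℝ × (ℝ × ℝ) => ((q.1, (q.2, b)) : ℝ × Pt p)) Set.univ := by
    fun_prop
  have hc : ContDiff ℝ ∞ fun q : ℝ × (ℝ × ℝ) => g (q.1, (q.2, b)) :=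
    contDiffOn_univ.1 (hg.comp h0 fun ζ _ => ⟨trivial, trivial, hb⟩)
  have e : ∀ ζ, fderiv ℝ (fun q : ℝ × (ℝ × ℝ) => g (q.1, (q.2, b))) (0, ζ) (1, 0)
      = pd (1, 0) g (0, (ζ, b)) := by
    intro ζ
    have hd : DifferentiableAt ℝ g (0, (ζ, b)) := differentiableAt_of_contDiffOn
      (isOpen_univ.prod (isOpen_univ_prod hU)) hg ⟨trivial, trivial, hb⟩
    have h1 : HasFDerivAt (fun q : ℝ × (ℝ × ℝ) => ((q.1, (q.2, b)) : ℝ × Pt p))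
        ((ContinuousLinearMap.fst ℝ ℝ (ℝ × ℝ)).prod
          ((ContinuousLinearMap.snd ℝ ℝ (ℝ × ℝ)).prod 0)) (0, ζ) :=
      hasFDerivAt_fst.prodMk (hasFDerivAt_snd.prodMk (hasFDerivAt_const b _))
    have h2 := HasFDerivAt.comp (0, ζ) (g := g) hd.hasFDerivAt h1
    have h3 : HasFDerivAt (fun q : ℝ × (ℝ × ℝ) => g (q.1, (q.2, b))) _ (0, ζ) := h2
    rw [h3.fderiv]
    rfl
  have h := hasDerivAt_setIntegral hc hK
  rwa [setIntegral_congr_fun hK.measurableSet fun ζ _ => e ζ] at h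

end Slices

/-! ### The first variation of the action. -/

section FirstVariation

open MeasureTheory

variable {p N L L' : ℕ} {U : Set (Fin p → ℝ)} {K : Set (ℝ × ℝ)} {b : Fin p → ℝ}

theorem contDiffOn_time_slice {f : ℝ × Pt p → Gr L}
    (hf : ContDiffOn ℝ ∞ f (Set.univ ×ˢ (Set.univ ×ˢ U))) (t : ℝ) :
    ContDiffOn ℝ ∞ (fun z => f (t, z)) (Set.univ ×ˢ U) :=
  hf.comp (by fun_prop) fun _ hz => ⟨trivial, hz⟩

/-- Regarding the odd fields as fields on ℝ × ℝ^{2|2} × B without time component allows ∂_t to be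
commuted past them by `pd_sd`. -/
theorem sd_time_slice (hU : IsOpen U) {f : ℝ × Pt p → Gr L}
    (hf : ContDiffOn ℝ ∞ f (Set.univ ×ˢ (Set.univ ×ˢ U))) (t : ℝ) {z : Pt p}
    (hz : z ∈ Set.univ ×ˢ U) (a : Fin 2) (v w : Pt p) :
    sd a v w (fun z => f (t, z)) z = sd a (0, v) (0, w) f (t, z) := by
  have hd : DifferentiableAt ℝ f (t, z) := differentiableAt_of_contDiffOn
    (isOpen_univ.prod (isOpen_univ_prod hU)) hf ⟨trivial, hz⟩
  have h1 : HasFDerivAt (fun z : Pt p => (t, z)) (ContinuousLinearMap.inr ℝ ℝ (Pt p)) z :=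
    hasFDerivAt_prodMk_right t z
  have h2 := HasFDerivAt.comp z (g := f) hd.hasFDerivAt h1
  have h3 : HasFDerivAt (fun z => f (t, z)) _ z := h2
  simp only [sd, pd, h3.fderiv]
  rfl

/-- The derivative at time zero of a family of functions. -/
noncomputable def velocity (Ψ : ℝ → Pt p → Vec N L) (z : Pt p) : Vec N L :=
  fun i => pd (1, 0) (fun q : ℝ × Pt p => Ψ q.1 q.2 i) (0, z)

/-- The symmetry `⟨D₁V, D₂Φ⟩ + ⟨D₁Φ, D₂V⟩ = -⟨V, (D₁D₂ - D₂D₁)Φ⟩` up to total derivatives. -/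
theorem Q₁_mul_Q₂_symm (hU : IsOpen U) {f g : Pt p → Gr L}
    (hf : ContDiffOn ℝ ∞ f (Set.univ ×ˢ U)) (hg : ContDiffOn ℝ ∞ g (Set.univ ×ˢ U))
    (hfe : ∀ z ∈ Set.univ ×ˢ U, inv (f z) = f z) (hge : ∀ z ∈ Set.univ ×ˢ U, inv (g z) = g z)
    {z : Pt p} (hz : z ∈ Set.univ ×ˢ U) :
    Q₁ f z * Q₂ g z + Q₁ g z * Q₂ f z
      = Q₁ (fun w => f w * Q₂ g w) z - Q₂ (fun w => f w * Q₁ g w) z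
        - (2 : ℂ) • (f z * superLaplacian g z) := by
  have hS := isOpen_univ_prod hU
  have h1 : Q₁ (fun w => f w * Q₂ g w) z = Q₁ f z * Q₂ g z + inv (f z) * Q₁ (Q₂ g) z :=
    sd_mul hS _ _ _ hf (contDiffOn_Q₂ hU hg) hz
  have h2 : Q₂ (fun w => f w * Q₁ g w) z = Q₂ f z * Q₁ g z + inv (f z) * Q₂ (Q₁ g) z :=
    sd_mul hS _ _ _ hf (contDiffOn_Q₁ hU hg) hz
  have h3 : inv (Q₂ f z) = -Q₂ f z := inv_sd_of_even hS _ _ _ hf hfe hz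
  have h4 : inv (Q₁ g z) = -Q₁ g z := inv_sd_of_even hS _ _ _ hg hge hz
  have h5 : Q₁ g z * Q₂ f z = -(Q₂ f z * Q₁ g z) := by rw [odd_mul_comm h4, h3, neg_mul]
  rw [h1, h2, h5, hfe z hz, Q₂_Q₁ hU hg hz, superLaplacian, mul_sub, mul_add, mul_neg,
    mul_smul_comm]
  module

variable {Φ : Pt p → Vec N L} {Ψ : ℝ → Pt p → Vec N L'} {h : L ≤ L'}

theorem IsVariation.smooth_apply (hΨ : IsVariation h U K Φ Ψ) (i : Fin N) :
    ContDiffOn ℝ ∞ (fun q : ℝ × Pt p => Ψ q.1 q.2 i) (Set.univ ×ˢ (Set.univ ×ˢ U)) :=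
  contDiffOn_pi.1 hΨ.smooth i

theorem isOpen_spacetime (hU : IsOpen U) :
    IsOpen (Set.univ ×ˢ (Set.univ ×ˢ U) : Set (ℝ × Pt p)) :=
  isOpen_univ.prod (isOpen_univ_prod hU)

theorem IsVariation.contDiffOn_velocity (hU : IsOpen U) (hΨ : IsVariation h U K Φ Ψ) (i : Fin N) :
    ContDiffOn ℝ ∞ (fun z => velocity Ψ z i) (Set.univ ×ˢ U) :=
  contDiffOn_time_slice (contDiffOn_pd (isOpen_spacetime hU) (hΨ.smooth_apply i) (1, 0)) 0

theorem IsVariation.inv_velocity (hU : IsOpen U) (hΨ : IsVariation h U K Φ Ψ) (i : Fin N) {z : Pt p}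
    (hz : z ∈ Set.univ ×ˢ U) : inv (velocity Ψ z i) = velocity Ψ z i :=
  inv_pd_of_even (isOpen_spacetime hU) _ (hΨ.smooth_apply i)
    (fun q hq => (hΨ.field q.1).inv_apply i q.2 hq.2) ⟨trivial, hz⟩

theorem IsVariation.hasDerivAt (hU : IsOpen U) (hΨ : IsVariation h U K Φ Ψ) (i : Fin N) {z : Pt p}
    (hz : z ∈ Set.univ ×ˢ U) : HasDerivAt (fun t => Ψ t z i) (velocity Ψ z i) 0 := by
  have h1 : HasDerivAt (fun t : ℝ => (t, z)) ((1 : ℝ), (0 : Pt p)) 0 :=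
    (hasDerivAt_id _).prodMk (hasDerivAt_const _ z)
  exact (differentiableAt_of_contDiffOn (isOpen_spacetime hU) (hΨ.smooth_apply i)
    (z := (0, z)) ⟨trivial, hz⟩).hasFDerivAt.comp_hasDerivAt (0 : ℝ) h1

theorem IsVariation.velocity_eq_zero (hU : IsOpen U) (hΨ : IsVariation h U K Φ Ψ) {z : Pt p}
    (hz : z ∈ Kᶜ ×ˢ U) (i : Fin N) : velocity Ψ z i = 0 := by
  have h1 := hΨ.hasDerivAt hU i (z := z) ⟨trivial, hz.2⟩
  have h2 : (fun t => Ψ t z i) = fun _ => extend h (Φ z i) :=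
    funext fun t => hΨ.support t z hz i
  rw [h2] at h1
  exact h1.unique (hasDerivAt_const _ _)

theorem IsVariation.sum_velocity_mul (hU : IsOpen U) (hΨ : IsVariation h U K Φ Ψ) {z : Pt p}
    (hz : z ∈ Set.univ ×ˢ U) : ∑ i, velocity Ψ z i * Ψ 0 z i = 0 := by
  have h1 := fun i => hΨ.hasDerivAt hU i hz
  have h2 : HasDerivAt (fun t => ∑ i, Ψ t z i * Ψ t z i)
      (∑ i, (Ψ 0 z i * velocity Ψ z i + velocity Ψ z i * Ψ 0 z i)) 0 :=
    HasDerivAt.fun_sum fun i _ => (mulCLM L').hasDerivAt_of_bilinear (fun _ => h1 i) (fun _ => h1 i)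
  have h3 : (fun t => ∑ i, Ψ t z i * Ψ t z i) = fun _ => 1 :=
    funext fun t => (hΨ.field t).sphere z hz
  rw [h3] at h2
  have h4 := h2.unique (hasDerivAt_const _ _)
  simp only [← even_mul_comm (hΨ.inv_velocity hU _ hz), ← two_smul ℂ, ← Finset.smul_sum] at h4
  exact (smul_eq_zero.1 h4).resolve_left two_ne_zero

/-- Differentiate ½⟨D₁Ψ, D₂Ψ⟩ under the integral and apply `Q₁_mul_Q₂_symm`. The terms Q₁G₁ and Q₂G₂
integrate to zero, as G₁ and G₂ vanish with the velocity outside `K`. -/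
theorem IsVariation.hasDerivAt_action (hU : IsOpen U) (hΨ : IsVariation h U K Φ Ψ)
    (hK : IsCompact K) (hb : b ∈ U) :
    HasDerivAt (fun t => action K (Ψ t) b)
      (-∫ ζ in K, berezin (∑ i, velocity Ψ (ζ, b) i
        * superLaplacian (fun w => Ψ 0 w i) (ζ, b))) 0 := by
  have hS := isOpen_univ_prod hU
  have hO := isOpen_spacetime hU
  have hf := hΨ.smooth_apply
  let A : Fin N → ℝ × Pt p → Gr L' := fun i =>
    sd 0 (0, -eX p) (0, -eY p) (fun q : ℝ × Pt p => Ψ q.1 q.2 i)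
  let B : Fin N → ℝ × Pt p → Gr L' := fun i =>
    sd 1 (0, -eY p) (0, eX p) (fun q : ℝ × Pt p => Ψ q.1 q.2 i)
  have hA : ∀ i, ContDiffOn ℝ ∞ (A i) (Set.univ ×ˢ (Set.univ ×ˢ U)) := fun i =>
    contDiffOn_sd hO _ _ _ (hf i)
  have hB : ∀ i, ContDiffOn ℝ ∞ (B i) (Set.univ ×ˢ (Set.univ ×ˢ U)) := fun i =>
    contDiffOn_sd hO _ _ _ (hf i)
  have hAB := fun i => contDiffOn_mul (hA i) (hB i)
  let l : Gr L' →ₗ[ℂ] Gr L' := (1 / 2 : ℂ) • berezin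
  have hsum : ContDiffOn ℝ ∞ (fun q => ∑ i, A i q * B i q) (Set.univ ×ˢ (Set.univ ×ˢ U)) :=
    ContDiffOn.sum fun i _ => hAB i
  have hlag : ∀ t, ∀ z ∈ Set.univ ×ˢ U, lagrangian (Ψ t) z = l (∑ i, A i (t, z) * B i (t, z)) := by
    intro t z hz
    rw [lagrangian_eq_berezin hU (hΨ.field t) hz]
    simp only [sd_time_slice hU (hf _) t hz, l, A, B, LinearMap.smul_apply]
  have hact : (fun t => action K (Ψ t) b)
      = fun t => ∫ ζ in K, l (∑ i, A i (t, (ζ, b)) * B i (t, (ζ, b))) :=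
    funext fun t => setIntegral_congr_fun hK.measurableSet fun ζ _ => hlag t _ ⟨trivial, hb⟩
  rw [hact]
  convert hasDerivAt_setIntegral_slice hU (contDiffOn_linear l hsum) hb hK using 1
  have hV := hΨ.contDiffOn_velocity hU
  have h0 := (hΨ.field 0).smooth_apply
  let G₁ : Pt p → Gr L' := fun z => ∑ i, velocity Ψ z i * Q₂ (fun w => Ψ 0 w i) z
  let G₂ : Pt p → Gr L' := fun z => ∑ i, velocity Ψ z i * Q₁ (fun w => Ψ 0 w i) z
  have hG₁' := fun i => contDiffOn_mul (hV i) (contDiffOn_Q₂ hU (h0 i))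
  have hG₂' := fun i => contDiffOn_mul (hV i) (contDiffOn_Q₁ hU (h0 i))
  have hG₁ : ContDiffOn ℝ ∞ G₁ (Set.univ ×ˢ U) := ContDiffOn.sum fun i _ => hG₁' i
  have hG₂ : ContDiffOn ℝ ∞ G₂ (Set.univ ×ˢ U) := ContDiffOn.sum fun i _ => hG₂' i
  have hsL : ContDiffOn ℝ ∞ (fun z => ∑ i, velocity Ψ z i * superLaplacian (fun w => Ψ 0 w i) z)
      (Set.univ ×ˢ U) :=
    ContDiffOn.sum fun i _ => contDiffOn_mul (hV i) (contDiffOn_superLaplacian hU (h0 i))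
  have hpt : ∀ z ∈ Set.univ ×ˢ U, pd (1, 0) (fun q => l (∑ i, A i q * B i q)) (0, z)
      = (1 / 2 : ℂ) • (berezin (Q₁ G₁ z) - berezin (Q₂ G₂ z))
        - berezin (∑ i, velocity Ψ z i * superLaplacian (fun w => Ψ 0 w i) z) := by
    intro z hz
    have hz' : ((0, z) : ℝ × Pt p) ∈ Set.univ ×ˢ (Set.univ ×ˢ U) := ⟨trivial, hz⟩
    have hdAB := fun i => differentiableAt_of_contDiffOn hO (hAB i) hz'
    rw [pd_linear _ l (differentiableAt_of_contDiffOn hO hsum hz')]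
    have e1 : pd (1, 0) (fun q => ∑ i, A i q * B i q) (0, z)
        = ∑ i, pd (1, 0) (fun q => A i q * B i q) (0, z) := by
      rw [pd, fderiv_fun_sum fun i _ => hdAB i]
      simp [pd]
    have e2 : ∀ i, pd (1, 0) (fun q => A i q * B i q) (0, z)
        = Q₁ (fun w => velocity Ψ w i) z * Q₂ (fun w => Ψ 0 w i) z
          + Q₁ (fun w => Ψ 0 w i) z * Q₂ (fun w => velocity Ψ w i) z := by
      intro i
      rw [pd_mul _ (differentiableAt_of_contDiffOn hO (hA i) hz')
        (differentiableAt_of_contDiffOn hO (hB i) hz'), pd_sd hO _ _ _ _ (hf i) hz',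
        pd_sd hO _ _ _ _ (hf i) hz',
        ← sd_time_slice hU (contDiffOn_pd hO (hf i) _) 0 hz,
        ← sd_time_slice hU (contDiffOn_pd hO (hf i) _) 0 hz]
      simp only [A, B]
      rw [← sd_time_slice hU (hf i) 0 hz, ← sd_time_slice hU (hf i) 0 hz]
      rfl
    have e3 : Q₁ G₁ z = ∑ i, Q₁ (fun w => velocity Ψ w i * Q₂ (fun w => Ψ 0 w i) w) z :=
      sd_sum hS _ _ _ _ hG₁' hz
    have e4 : Q₂ G₂ z = ∑ i, Q₂ (fun w => velocity Ψ w i * Q₁ (fun w => Ψ 0 w i) w) z :=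
      sd_sum hS _ _ _ _ hG₂' hz
    rw [e1, Finset.sum_congr rfl fun i _ => (e2 i).trans (Q₁_mul_Q₂_symm hU (hV i) (h0 i)
      (fun z hz => hΨ.inv_velocity hU i hz) ((hΨ.field 0).inv_apply i) hz),
      Finset.sum_sub_distrib, Finset.sum_sub_distrib, ← e3, ← e4, ← Finset.smul_sum]
    simp only [l, LinearMap.smul_apply, map_sub, map_smul]
    module
  have hb1 : ContDiffOn ℝ ∞ (fun z => berezin (Q₁ G₁ z)) (Set.univ ×ˢ U) :=
    contDiffOn_linear berezin (contDiffOn_Q₁ hU hG₁)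
  have hb2 : ContDiffOn ℝ ∞ (fun z => berezin (Q₂ G₂ z)) (Set.univ ×ˢ U) :=
    contDiffOn_linear berezin (contDiffOn_Q₂ hU hG₂)
  have hz1 : ∀ z ∈ Kᶜ ×ˢ U, G₁ z = 0 := fun z hz =>
    Finset.sum_eq_zero fun i _ => by rw [hΨ.velocity_eq_zero hU hz, zero_mul]
  have hz2 : ∀ z ∈ Kᶜ ×ˢ U, G₂ z = 0 := fun z hz =>
    Finset.sum_eq_zero fun i _ => by rw [hΨ.velocity_eq_zero hU hz, zero_mul]
  have nX : -eX p = ((-1, 0), 0) := by simp [eX]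
  have nY : -eY p = ((0, -1), 0) := by simp [eY]
  have i1 : ∫ ζ in K, berezin (Q₁ G₁ (ζ, b)) = 0 := by
    have := setIntegral_berezin_sd hU hG₁ hb hK hz1 0 (-1, 0) (0, -1)
    rwa [← nX, ← nY] at this
  have i2 : ∫ ζ in K, berezin (Q₂ G₂ (ζ, b)) = 0 := by
    have := setIntegral_berezin_sd hU hG₂ hb hK hz2 1 (0, -1) (1, 0)
    rwa [← nY] at this
  rw [setIntegral_congr_fun hK.measurableSet fun ζ _ => hpt (ζ, b) ⟨trivial, hb⟩, integral_sub,
    integral_smul, integral_sub (integrableOn_slice hb1 hb hK) (integrableOn_slice hb2 hb hK), i1,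
    i2, sub_zero, smul_zero, zero_sub]
  · exact ((integrableOn_slice hb1 hb hK).sub (integrableOn_slice hb2 hb hK)).smul (1 / 2 : ℂ)
  · exact integrableOn_slice (contDiffOn_linear berezin hsL) hb hK

end FirstVariation

/-! ### Adjoining odd parameters, and detecting zero with them. -/

section Extension

variable {p N L L' : ℕ} {U : Set (Fin p → ℝ)}

theorem gen_mem_realPart (i : Fin (2 + L)) : gen i ∈ realPart L :=
  Algebra.subset_adjoin ⟨i, rfl⟩

theorem extend_mem_realPart (h : L ≤ L') {x : Gr L} (hx : x ∈ realPart L) :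
    extend h x ∈ realPart L' := by
  have hle : realPart L ≤ (realPart L').comap ((extend h).restrictScalars ℝ) := by
    refine Algebra.adjoin_le ?_
    rintro _ ⟨i, rfl⟩
    change extend h (gen i) ∈ realPart L'
    rw [extend_gen]
    exact gen_mem_realPart _
  exact hle hx

theorem IsSuperfield.pullback {Φ : Pt p → Vec N L} (hΦ : IsSuperfield U Φ) (h : L ≤ L') :
    IsSuperfield U fun z i => extend h (Φ z i) where
  smooth := contDiffOn_pi.2 fun i => contDiffOn_linear (extend h).toLinearMap (hΦ.smooth_apply i)
  real z hz i := extend_mem_realPart h (hΦ.real z hz i)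
  even z hz i := by rw [mem_evenPart, inv_extend, hΦ.inv_apply i z hz]

theorem pair_extend (h : L ≤ L') (v w : Vec N L) :
    pair (fun i => extend h (v i)) (fun i => extend h (w i)) = extend h (pair v w) := by
  simp [pair]

/-- Agreement of `g` with the extension of `f` is asked only over `U`, which is all that
`IsVariation.start` supplies; openness of `U` makes the derivatives agree too. -/
theorem superLaplacian_extend (hU : IsOpen U) (h : L ≤ L') {f : Pt p → Gr L} {g : Pt p → Gr L'}
    (hf : ContDiffOn ℝ ∞ f (Set.univ ×ˢ U))
    (hg : Set.EqOn g (fun z => extend h (f z)) (Set.univ ×ˢ U)) {z : Pt p}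
    (hz : z ∈ Set.univ ×ˢ U) : superLaplacian g z = extend h (superLaplacian f z) := by
  have hS := isOpen_univ_prod hU
  have h1 : Set.EqOn (Q₂ g) (fun z => extend h (Q₂ f z)) (Set.univ ×ˢ U) := fun y hy =>
    (sd_congr hS _ _ _ hg hy).trans (sd_extend hS _ _ _ h hf hy)
  have h2 : Q₁ (Q₂ g) z = extend h (Q₁ (Q₂ f) z) :=
    (sd_congr hS _ _ _ h1 hz).trans (sd_extend hS _ _ _ h (contDiffOn_Q₂ hU hf) hz)
  have h3 : pd (eY p) g z = extend h (pd (eY p) f z) :=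
    (pd_congr hS hg hz _).trans
      (pd_linear _ (extend h).toLinearMap (differentiableAt_of_contDiffOn hS hf hz))
  rw [superLaplacian, h2, h3, superLaplacian, map_add]

/-- Contracting with the dual of the new generator `k` strips it off, because that contraction
annihilates the image of `extend`. -/
theorem eq_zero_of_gen_mul_extend (h : L ≤ L') {k : Fin (2 + L')}
    (hk : ∀ i : Fin (2 + L), Fin.castLE (Nat.add_le_add_left h 2) i ≠ k) {x : Gr L}
    (hx : gen k * extend h x = 0) : x = 0 := by
  have h1 := contract_gen_mul (Finsupp.lapply k) k (extend h x)
  rw [contract_extend_eq_zero h _ (fun i => by simp [hk i]), hx] at h1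
  refine extend_injective h ?_
  simpa using h1.symm

theorem eq_zero_of_gen_mul_gen_mul_extend (h : L ≤ L') {k l : Fin (2 + L')} (hkl : l ≠ k)
    (hk : ∀ i : Fin (2 + L), Fin.castLE (Nat.add_le_add_left h 2) i ≠ k)
    (hl : ∀ i : Fin (2 + L), Fin.castLE (Nat.add_le_add_left h 2) i ≠ l) {x : Gr L}
    (hx : gen k * (gen l * extend h x) = 0) : x = 0 := by
  refine eq_zero_of_gen_mul_extend h hl ?_
  have h1 := contract_gen_mul (Finsupp.lapply k) k (gen l * extend h x)
  rw [contract_gen_mul _ l, contract_extend_eq_zero h _ (fun i => by simp [hk i]), hx] at h1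
  simpa [hkl] using h1.symm

/-- Pairing with all even products of two generators detects zero, once two odd parameters are
adjoined. -/
theorem eq_zero_of_berezin_gen_mul (h : L ≤ L + 2) {x : Gr L}
    (hx : ∀ c d : Fin (2 + (L + 2)), berezin (gen c * gen d * extend h x) = 0) : x = 0 := by
  let k : Fin (L + 2) := Fin.natAdd L 0
  let l : Fin (L + 2) := Fin.natAdd L 1
  have hk : ∀ i : Fin (2 + L), Fin.castLE (Nat.add_le_add_left h 2) i ≠ Fin.natAdd 2 k := by
    intro i hi
    have := congrArg Fin.val hi
    simp [k] at this
    omega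
  have hl : ∀ i : Fin (2 + L), Fin.castLE (Nat.add_le_add_left h 2) i ≠ Fin.natAdd 2 l := by
    intro i hi
    have := congrArg Fin.val hi
    simp [l] at this
    omega
  have hkl : Fin.natAdd 2 l ≠ Fin.natAdd 2 k := by simp [k, l]
  -- The multipliers θ₁θ₂, θ₂η, θ₁η and ηη', with η, η' the new parameters, isolate the coefficients
  -- of 1, θ₁, θ₂ and θ₁θ₂ respectively. An even multiplier reaches the odd coefficients only by
  -- means of an auxiliary η.
  refine eq_zero_of_components ?_ ?_ ?_ ?_
  · have h1 := hx (Fin.castAdd _ 0) (Fin.castAdd _ 1)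
    rw [← θ, ← θ, mul_assoc] at h1
    simp only [berezin_apply, dθ_θ_mul] at h1
    simp [dθ_θ_mul, restr_θ, restr_extend] at h1
    exact extend_injective h (by simpa using h1)
  · have h1 := hx (Fin.castAdd _ 1) (Fin.natAdd 2 k)
    rw [← θ, mul_assoc] at h1
    simp [berezin_apply, dθ_θ_mul, dθ_gen_natAdd_mul, restr_θ, restr_gen_natAdd, dθ_extend,
      restr_extend] at h1
    exact eq_zero_of_gen_mul_extend h hk h1
  · have h1 := hx (Fin.castAdd _ 0) (Fin.natAdd 2 k)
    rw [← θ, mul_assoc] at h1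
    simp [berezin_apply, dθ_θ_mul, dθ_gen_natAdd_mul, restr_θ, restr_gen_natAdd, dθ_extend,
      restr_extend] at h1
    exact eq_zero_of_gen_mul_extend h hk h1
  · have h1 := hx (Fin.natAdd 2 k) (Fin.natAdd 2 l)
    rw [mul_assoc] at h1
    simp only [berezin_apply, dθ_gen_natAdd_mul, restr_gen_natAdd, dθ_extend, map_mul,
      restr_extend, mul_neg, neg_neg] at h1
    exact eq_zero_of_gen_mul_gen_mul_extend h hkl hk hl h1

end Extension

/-! ### Variations with nilpotent velocity and the weak field equation. -/

section NilpotentVariation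

open MeasureTheory

variable {p N L L' : ℕ} {U : Set (Fin p → ℝ)} {K : Set (ℝ × ℝ)} {Φ : Pt p → Vec N L}
  {h : L ≤ L'} {m : Gr L'} {B : Pt p → Vec N L'} {ρ : ℝ × ℝ → ℝ}

/-- The variation with velocity `ρ m B`, for `m` even with `m² = 0` and `B` tangent to the sphere
along `Φ`. -/
noncomputable def nilpotentVariation (h : L ≤ L') (Φ : Pt p → Vec N L) (m : Gr L')
    (B : Pt p → Vec N L') (ρ : ℝ × ℝ → ℝ) (t : ℝ) (z : Pt p) : Vec N L' :=
  fun i => extend h (Φ z i) + (t * ρ z.1) • (m * B z i)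

theorem inv_real_smul (r : ℝ) (x : Gr L) : inv (r • x) = r • inv x :=
  map_smul inv (r : ℂ) x

theorem berezin_real_smul (r : ℝ) (x : Gr L) : berezin (r • x) = r • berezin x :=
  map_smul berezin (r : ℂ) x

/-- In |Φ + tρmB|² the linear term vanishes by tangency of `B` and the quadratic one by `m * m = 0`.
The affine family therefore stays on the sphere, with no projection back. -/
theorem isVariation_nilpotentVariation (hΦ : IsSphereSuperfield U Φ) (hB : IsSuperfield U B)
    (hm : inv m = m) (hmr : m ∈ realPart L') (hmm : m * m = 0) (hρ : ContDiff ℝ ∞ ρ)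
    (hρK : ∀ ζ ∉ K, ρ ζ = 0)
    (ht : ∀ z ∈ Set.univ ×ˢ U, ∑ i, extend h (Φ z i) * B z i = 0) :
    IsVariation h U K Φ (nilpotentVariation h Φ m B ρ) := by
  have hs : ContDiffOn ℝ ∞ (fun q : ℝ × Pt p => nilpotentVariation h Φ m B ρ q.1 q.2)
      (Set.univ ×ˢ (Set.univ ×ˢ U)) := by
    have hr : ContDiff ℝ ∞ fun q : ℝ × Pt p => q.1 * ρ q.2.1 :=
      contDiff_fst.mul (hρ.comp (contDiff_fst.comp contDiff_snd))
    refine contDiffOn_pi.2 fun i => ContDiffOn.add ?_ (hr.contDiffOn.smul ?_)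
    · exact ((hΦ.toIsSuperfield.pullback h).smooth_apply i).comp contDiffOn_snd fun q hq => hq.2
    · exact contDiffOn_mul contDiffOn_const
        ((hB.smooth_apply i).comp contDiffOn_snd fun q hq => hq.2)
  refine ⟨hs, fun t => ⟨⟨?_, ?_, ?_⟩, ?_⟩, ?_, ?_⟩
  · exact hs.comp (t := Set.univ ×ˢ (Set.univ ×ˢ U)) (contDiff_prodMk_right t).contDiffOn
      fun z hz => ⟨trivial, hz⟩
  · exact fun z hz i => add_mem (extend_mem_realPart h (hΦ.real z hz i))
      (Subalgebra.smul_mem _ (mul_mem hmr (hB.real z hz i)) _)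
  · intro z hz i
    rw [mem_evenPart, nilpotentVariation, map_add, inv_real_smul, map_mul, hm, hB.inv_apply i z hz,
      inv_extend, hΦ.inv_apply i z hz]
  · intro z hz
    have e : ∀ i, nilpotentVariation h Φ m B ρ t z i * nilpotentVariation h Φ m B ρ t z i
        = extend h (Φ z i) * extend h (Φ z i)
          + (2 * (t * ρ z.1)) • (m * (extend h (Φ z i) * B z i)) := by
      intro i
      have c1 : m * B z i * extend h (Φ z i) = m * (extend h (Φ z i) * B z i) := by
        rw [mul_assoc, even_mul_comm (hB.inv_apply i z hz)]
      have c2 : extend h (Φ z i) * (m * B z i) = m * (extend h (Φ z i) * B z i) := by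
        rw [← mul_assoc, ← even_mul_comm hm, mul_assoc]
      have c3 : m * B z i * (m * B z i) = 0 := by
        rw [mul_assoc, ← mul_assoc (B z i), ← even_mul_comm hm (B z i), mul_assoc m, ← mul_assoc m m,
          hmm, zero_mul]
      simp only [nilpotentVariation, add_mul, mul_add, smul_mul_assoc, mul_smul_comm, c1, c2, c3,
        smul_zero, add_zero]
      module
    rw [pair, Finset.sum_congr rfl fun i _ => e i, Finset.sum_add_distrib, ← Finset.smul_sum,
      ← Finset.mul_sum, ht z hz, mul_zero, smul_zero, add_zero]
    exact (pair_extend h (Φ z) (Φ z)).trans (by rw [hΦ.sphere z hz, map_one])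
  · intro z _ i
    simp [nilpotentVariation]
  · intro t z hz i
    simp [nilpotentVariation, hρK z.1 hz.1]

theorem velocity_nilpotentVariation (hU : IsOpen U)
    (hΨ : IsVariation h U K Φ (nilpotentVariation h Φ m B ρ)) {z : Pt p}
    (hz : z ∈ Set.univ ×ˢ U) (i : Fin N) :
    velocity (nilpotentVariation h Φ m B ρ) z i = ρ z.1 • (m * B z i) := by
  refine (hΨ.hasDerivAt hU i hz).unique ?_
  have h1 : HasDerivAt (fun t : ℝ => (t * ρ z.1) • (m * B z i)) ((1 * ρ z.1) • (m * B z i)) 0 :=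
    ((hasDerivAt_id (0 : ℝ)).mul_const (ρ z.1)).smul_const _
  rw [one_mul] at h1
  exact h1.const_add _

/-- The weak form of the field equation. -/
theorem IsSuperharmonic.berezin_eq_zero (hU : IsOpen U) (hΦ : IsSphereSuperfield U Φ)
    (hsh : IsSuperharmonic U Φ) (h : L ≤ L') (hB : IsSuperfield U B) (hm : inv m = m)
    (hmr : m ∈ realPart L') (hmm : m * m = 0)
    (ht : ∀ z ∈ Set.univ ×ˢ U, ∑ i, extend h (Φ z i) * B z i = 0) {z : Pt p}
    (hz : z ∈ Set.univ ×ˢ U) :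
    berezin (m * ∑ i, B z i * extend h (superLaplacian (fun w => Φ w i) z)) = 0 := by
  let f : Pt p → Gr L' := fun z =>
    berezin (m * ∑ i, B z i * extend h (superLaplacian (fun w => Φ w i) z))
  have hf : ContDiffOn ℝ ∞ f (Set.univ ×ˢ U) :=
    contDiffOn_linear berezin (contDiffOn_mul contDiffOn_const (ContDiffOn.sum fun i _ =>
      contDiffOn_mul (hB.smooth_apply i) (contDiffOn_linear (extend h).toLinearMap
        (contDiffOn_superLaplacian hU (hΦ.smooth_apply i)))))
  have hc : Continuous fun ζ : ℝ × ℝ => f (ζ, z.2) := (contDiff_slice hf hz.2).continuous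
  -- Fundamental lemma of the calculus of variations on the slice at `z.2`, with `K` the support of
  -- the test function; continuity then upgrades "almost everywhere" to "everywhere".
  have hae : ∀ᵐ ζ : ℝ × ℝ, f (ζ, z.2) = 0 := by
    refine ae_eq_zero_of_integral_contDiff_smul_eq_zero hc.locallyIntegrable fun ρ hρ hρc => ?_
    have hK : IsCompact (tsupport ρ) := hρc
    have hρK : ∀ ζ ∉ tsupport ρ, ρ ζ = 0 := fun ζ hζ => image_eq_zero_of_notMem_tsupport hζ
    have hΨ := isVariation_nilpotentVariation hΦ hB hm hmr hmm hρ hρK ht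
    have h1 := (hΨ.hasDerivAt_action hU hK hz.2).unique (hsh L' h _ hK _ hΨ z.2 hz.2)
    rw [neg_eq_zero] at h1
    rw [← setIntegral_eq_integral_of_forall_compl_eq_zero (s := tsupport ρ)
      (fun ζ hζ => by rw [hρK ζ hζ, zero_smul]), ← h1]
    refine setIntegral_congr_fun hK.measurableSet fun ζ _ => ?_
    have hζ : ((ζ, z.2) : Pt p) ∈ Set.univ ×ˢ U := ⟨trivial, hz.2⟩
    have h2 : ∀ i, velocity (nilpotentVariation h Φ m B ρ) (ζ, z.2) i
        * superLaplacian (fun w => nilpotentVariation h Φ m B ρ 0 w i) (ζ, z.2)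
        = ρ ζ • (m * (B (ζ, z.2) i * extend h (superLaplacian (fun w => Φ w i) (ζ, z.2)))) := by
      intro i
      rw [velocity_nilpotentVariation hU hΨ hζ, superLaplacian_extend hU h (hΦ.smooth_apply i)
        (fun w hw => hΨ.start w hw i) hζ, smul_mul_assoc, mul_assoc]
    simp only [h2, ← Finset.smul_sum, ← Finset.mul_sum, berezin_real_smul, f]
  have h0 : (fun ζ : ℝ × ℝ => f (ζ, z.2)) = fun _ => 0 :=
    (hc.ae_eq_iff_eq volume continuous_const).1 hae
  exact congrFun h0 z.1

end NilpotentVariation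

/-! ### Equivalence of criticality and the field equation. -/

section Criticality

variable {p N L : ℕ} {U : Set (Fin p → ℝ)} {Φ : Pt p → Vec N L}

/-- The Laplacian of Φ is a multiple of Φ, and the velocity of any variation is orthogonal to Φ. -/
theorem isSuperharmonic_of_equation (hU : IsOpen U) (hΦ : IsSphereSuperfield U Φ)
    (heq : ∀ z ∈ Set.univ ×ˢ U, ∀ i,
      superLaplacian (fun w => Φ w i) z + density Φ z * Φ z i = 0) :
    IsSuperharmonic U Φ := by
  intro L' h K hK Ψ hΨ b hb
  have h1 := hΨ.hasDerivAt_action hU hK hb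
  rwa [MeasureTheory.setIntegral_congr_fun (g := fun _ => 0) hK.measurableSet,
    MeasureTheory.integral_zero, neg_zero] at h1
  intro ζ _
  have hz : ((ζ, b) : Pt p) ∈ Set.univ ×ˢ U := ⟨trivial, hb⟩
  have h2 : ∀ i, velocity Ψ (ζ, b) i * superLaplacian (fun w => Ψ 0 w i) (ζ, b)
      = -(extend h (density Φ (ζ, b)) * (velocity Ψ (ζ, b) i * Ψ 0 (ζ, b) i)) := by
    intro i
    rw [superLaplacian_extend hU h (hΦ.smooth_apply i) (fun w hw => hΨ.start w hw i) hz,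
      eq_neg_of_add_eq_zero_left (heq _ hz i), map_neg, map_mul, ← hΨ.start _ hz i, mul_neg,
      ← mul_assoc, ← mul_assoc, even_mul_comm (hΨ.inv_velocity hU i hz)]
  simp only [h2, Finset.sum_neg_distrib, ← Finset.mul_sum, hΨ.sum_velocity_mul hU hz, mul_zero,
    neg_zero, map_zero]

theorem IsSuperharmonic.commutator_eq_zero (hU : IsOpen U) (hΦ : IsSphereSuperfield U Φ)
    (hsh : IsSuperharmonic U Φ) {z : Pt p} (hz : z ∈ Set.univ ×ˢ U) (i j : Fin N) :
    Φ z j * superLaplacian (fun w => Φ w i) z - Φ z i * superLaplacian (fun w => Φ w j) z = 0 := by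
  have h : L ≤ L + 2 := Nat.le_add_right L 2
  refine eq_zero_of_berezin_gen_mul h fun c d => ?_
  -- The infinitesimal rotation Φⱼeᵢ - Φᵢeⱼ is tangent because even elements commute; pairing it
  -- with ΔΦ produces the commutator.
  let B : Pt p → Vec N (L + 2) := fun z k =>
    (if k = i then extend h (Φ z j) else 0) - (if k = j then extend h (Φ z i) else 0)
  have hΦ' := hΦ.toIsSuperfield.pullback h
  have hB : IsSuperfield U B := by
    refine ⟨contDiffOn_pi.2 fun k => ContDiffOn.sub ?_ ?_, fun z hz k => sub_mem ?_ ?_,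
      fun z hz k => sub_mem ?_ ?_⟩
    · split_ifs
      exacts [hΦ'.smooth_apply j, contDiffOn_const]
    · split_ifs
      exacts [hΦ'.smooth_apply i, contDiffOn_const]
    · split_ifs
      exacts [hΦ'.real z hz j, zero_mem _]
    · split_ifs
      exacts [hΦ'.real z hz i, zero_mem _]
    · split_ifs
      exacts [hΦ'.even z hz j, zero_mem _]
    · split_ifs
      exacts [hΦ'.even z hz i, zero_mem _]
  have hm : inv (gen c * gen d : Gr (L + 2)) = gen c * gen d := by simp
  have hmm : (gen c * gen d * (gen c * gen d) : Gr (L + 2)) = 0 := by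
    rw [mul_assoc, ← even_mul_comm hm, mul_assoc, gen_mul_self, mul_zero, mul_zero]
  have key := hsh.berezin_eq_zero hU hΦ h hB hm (mul_mem (gen_mem_realPart c) (gen_mem_realPart d))
    hmm (fun y hy => ?_) hz
  · simpa [B, sub_mul, ite_mul, Finset.sum_sub_distrib] using key
  · simp only [B, mul_sub, mul_ite, mul_zero, Finset.sum_sub_distrib, Finset.sum_ite_eq',
      Finset.mem_univ, if_true]
    rw [even_mul_comm (hΦ'.inv_apply i y hy), sub_self]

/-- Multiply the commutator identity by Φⱼ and sum over `j`: |Φ|² = 1 isolates ΔΦᵢ, and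
`sum_mul_superLaplacian` evaluates the multiplier ⟨Φ, ΔΦ⟩. -/
theorem IsSuperharmonic.equation (hU : IsOpen U) (hΦ : IsSphereSuperfield U Φ)
    (hsh : IsSuperharmonic U Φ) {z : Pt p} (hz : z ∈ Set.univ ×ˢ U) (i : Fin N) :
    superLaplacian (fun w => Φ w i) z + density Φ z * Φ z i = 0 := by
  have h1 : ∀ j, Φ z j * (Φ z j * superLaplacian (fun w => Φ w i) z)
      = Φ z i * (Φ z j * superLaplacian (fun w => Φ w j) z) := fun j => by
    rw [sub_eq_zero.1 (hsh.commutator_eq_zero hU hΦ hz i j), ← mul_assoc, ← mul_assoc,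
      even_mul_comm (hΦ.inv_apply j z hz)]
  have h2 := Finset.sum_congr (s₁ := Finset.univ) rfl fun j _ => h1 j
  simp only [← mul_assoc] at h2
  rw [← Finset.sum_mul, show ∑ j, Φ z j * Φ z j = 1 from hΦ.sphere z hz, one_mul] at h2
  simp only [mul_assoc] at h2
  rw [← Finset.mul_sum, sum_mul_superLaplacian hU hΦ hz] at h2
  rw [h2, mul_neg, even_mul_comm (hΦ.inv_apply i z hz), neg_add_cancel]

end Criticality

end SuperSphere

theorem mainTheorem7 (n p L : ℕ) (U : Set (Fin p → ℝ)) (hU : IsOpen U)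
    (Φ : SuperSphere.Pt p → SuperSphere.Vec (n + 1) L)
    (hΦ : SuperSphere.IsSphereSuperfield U Φ) :
    SuperSphere.IsSuperharmonic U Φ ↔
      ∀ z ∈ Set.univ ×ˢ U, ∀ i,
        SuperSphere.coordwise SuperSphere.Dbar
            (SuperSphere.coordwise SuperSphere.D Φ) z i
          + SuperSphere.pair
              (SuperSphere.coordwise SuperSphere.Dbar Φ z)
              (SuperSphere.coordwise SuperSphere.D Φ z) * Φ z i = 0 := by
  refine ⟨fun hsh z hz i => ?_, fun heq => ?_⟩
  · exact (SuperSphere.fieldEquation_iff hU hΦ.toIsSuperfield hz i).2 (hsh.equation hU hΦ hz i)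
  · exact SuperSphere.isSuperharmonic_of_equation hU hΦ fun z hz i =>
      (SuperSphere.fieldEquation_iff hU hΦ.toIsSuperfield hz i).1 (heq z hz i)
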